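/- Let $X$ be a compact complex manifold of dimension $n$ with canonical bundle $K_X$. Let $L$ be a holomorphic line bundle on $X$ with a smooth hermitian metric $h_L$ whose curvature form $\theta=c_1(L,h_L)$ is semipositive, and let $A$ be a holomorphic line bundle on $X$ with a smooth hermitian metric $h_A$ whose curvature form $\omega=c_1(A,h_A)$ is positive (so $X$ is projective). Here $c_1(L,h)=\frac{i}{2\pi}\partial\bar\partial\varphi$ locally, where $|e|_h^2=e^{-\varphi}$ for a local holomorphic frame $e$. For a rational number $\epsilon>0$ and an integer $k\ge 1$ with $k\epsilon\in\mathbb N$, put $V_{k,\epsilon}=H^0(X,L^{k}\otimes A^{k\epsilon}\otimes K_X)$. For $s_1,s_2\in V_{k,\epsilon}$, written locally as $s_j=f_j\,e_L^{k}\otimes e_A^{k\epsilon}\otimes dz_1\wedge\dots\wedge dz_n$, let $$\langle s_1,s_2\rangle=f_1\overline{f_2}\,|e_L|_{h_L}^{2k}\,|e_A|_{h_A}^{2k\epsilon}\left(\tfrac i2\right)^n dz_1\wedge d\bar z_1\wedge\dots\wedge dz_n\wedge d\bar z_n,\qquad (s_1,s_2)=\int_X\langle s_1,s_2\rangle .$$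 The $\epsilon$-twisted Bergman measure is the $(n,n)$-form $B_{k,\epsilon}=\sum_j\langle\sigma_j,\sigma_j\rangle$, where $(\sigma_j)_j$ is any orthonormal basis of $V_{k,\epsilon}$ for $(\cdot,\cdot)$. Then there are functions $\rho_k,\widetilde\rho_k:X\to\mathbb R$ ($k\in\mathbb N$), not depending on $\epsilon$, with $\rho_k\to0$ and $\widetilde\rho_k\to0$ uniformly on $X$ as $k\to\infty$, and an integer $k_0$, such that for every rational $\epsilon>0$ and every $k\ge k_0$ with $k\epsilon\in\mathbb N$ the space $V_{k,\epsilon}$ has a finite orthonormal basis and, as $(n,n)$-forms at every point of $X$, $$\frac{n!}{k^n}\,B_{k,\epsilon}\le\frac{e^{\rho_k+\epsilon\widetilde\rho_k}}{\bigl(1-e^{-\epsilon(\log k)^2}\bigr)^n}\,(\theta+\epsilon\omega)^n .$$ -/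

import Mathlib

open scoped Manifold ContDiff TensorProduct ComplexConjugate ComplexOrder

noncomputable section

namespace AdjointBergman

section Charts

variable {n : ℕ} {X : Type*} [TopologicalSpace X] [ChartedSpace (Fin n → ℂ) X]

/-- The part of the coordinate space of the preferred chart at `p` that corresponds to `S ⊆ X`. -/
def coordSet (p : X) (S : Set X) : Set (Fin n → ℂ) :=
  (chartAt (Fin n → ℂ) p).target ∩ (chartAt (Fin n → ℂ) p).symm ⁻¹' S

/-- The point of `X` whose coordinates in the preferred chart at `p` are `z`. -/
def pt (p : X) (z : Fin n → ℂ) : X := (chartAt (Fin n → ℂ) p).symm z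

/-- The coordinate vector field `∂/∂z_j` of the preferred chart at `p`, at the point with
coordinates `z`. -/
def coordVec (p : X) (z : Fin n → ℂ) (j : Fin n) :
    TangentSpace 𝓘(ℂ, Fin n → ℂ) (pt p z) :=
  mfderiv 𝓘(ℂ, Fin n → ℂ) 𝓘(ℂ, Fin n → ℂ) (pt (X := X) p) z (Pi.single j (1 : ℂ))

end Charts

/-- The Wirtinger derivative `∂f/∂z_j = (∂f/∂x_j - i ∂f/∂y_j) / 2`. -/
def dz {n : ℕ} (j : Fin n) (f : (Fin n → ℂ) → ℂ) (z : Fin n → ℂ) : ℂ :=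
  (1 / 2) * (fderiv ℝ f z (Pi.single j 1) - Complex.I * fderiv ℝ f z (Pi.single j Complex.I))

/-- The Wirtinger derivative `∂f/∂z̄_j = (∂f/∂x_j + i ∂f/∂y_j) / 2`. -/
def dzbar {n : ℕ} (j : Fin n) (f : (Fin n → ℂ) → ℂ) (z : Fin n → ℂ) : ℂ :=
  (1 / 2) * (fderiv ℝ f z (Pi.single j 1) + Complex.I * fderiv ℝ f z (Pi.single j Complex.I))

section OneBundle

variable {n : ℕ} {X : Type*} [TopologicalSpace X] [ChartedSpace (Fin n → ℂ) X]
  (L : X → Type*) [TopologicalSpace (Bundle.TotalSpace ℂ L)] [∀ x, TopologicalSpace (L x)]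
  [∀ x, AddCommGroup (L x)] [∀ x, Module ℂ (L x)] [FiberBundle ℂ L] [VectorBundle ℂ ℂ L]

/-- An open neighbourhood of `p` that carries both the preferred coordinates at `p` and the
preferred local frame of `L` at `p`. -/
def frameNhd (p : X) : Set X :=
  (chartAt (Fin n → ℂ) p).source ∩ (trivializationAt ℂ L p).baseSet

/-- The preferred local holomorphic frame of the line bundle `L` near `p`. -/
def frame (p x : X) : L x := (trivializationAt ℂ L p).symm x (1 : ℂ)

/-- A smooth hermitian metric on the line bundle `L`: a positive definite hermitian form on each
fibre (linear in the first variable) such that the squared norms of the local holomorphic frames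
are smooth functions in the real sense. -/
structure HermitianMetric where
  inner : ∀ x, L x →ₗ[ℂ] L x →ₗ⋆[ℂ] ℂ
  symm : ∀ x (v w : L x), conj (inner x v w) = inner x w v
  pos : ∀ x (v : L x), v ≠ 0 → 0 < (inner x v v).re
  smooth : ∀ p : X, ContDiffOn ℝ ∞
    (fun z : Fin n → ℂ => (inner (pt p z) (frame L p (pt p z)) (frame L p (pt p z))).re)
    (coordSet p (frameNhd (n := n) L p))

variable {L}

/-- The squared norm of the preferred frame at `p`, in the coordinates at `p`. -/
def HermitianMetric.frameNormSq (h : HermitianMetric (n := n) L) (p : X) (z : Fin n → ℂ) : ℝ :=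
  (h.inner (pt p z) (frame L p (pt p z)) (frame L p (pt p z))).re

/-- The local weight `φ` of the metric, given by `|e|² = exp (-φ)` for the preferred frame `e`. -/
def HermitianMetric.weight (h : HermitianMetric (n := n) L) (p : X) (z : Fin n → ℂ) : ℝ :=
  -Real.log (h.frameNormSq p z)

/-- The matrix `(∂²φ/∂z_j∂z̄_k)` of the Chern curvature form
`c₁(L,h) = dd^c φ = (i/2π) ∑ (∂²φ/∂z_j∂z̄_k) dz_j ∧ dz̄_k` in the coordinates at `p`. -/
def HermitianMetric.curvature (h : HermitianMetric (n := n) L) (p : X) (z : Fin n → ℂ) :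
    Matrix (Fin n) (Fin n) ℂ :=
  Matrix.of fun j k => dz j (dzbar k (fun w => (h.weight p w : ℂ))) z

/-- The curvature form is a semipositive `(1,1)`-form. -/
def HermitianMetric.Semipositive (h : HermitianMetric (n := n) L) : Prop :=
  ∀ p : X, ∀ z ∈ coordSet p (frameNhd (n := n) L p), (h.curvature p z).PosSemidef

/-- The curvature form is a positive `(1,1)`-form, i.e. a Kähler form. -/
def HermitianMetric.Positive (h : HermitianMetric (n := n) L) : Prop :=
  ∀ p : X, ∀ z ∈ coordSet p (frameNhd (n := n) L p), (h.curvature p z).PosDef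

end OneBundle

/-- For a real `(1,1)`-form `α = (i/2π) ∑ H_{jk} dz_j ∧ dz̄_k`, the density of the top power `αⁿ`
with respect to `dV = (i/2)ⁿ dz_1 ∧ dz̄_1 ∧ ⋯ ∧ dz_n ∧ dz̄_n`, which is Lebesgue measure. Expanding
the power, only the terms with distinct `dz_j` and distinct `dz̄_k` survive, and they are signed
multiples of `dV / πⁿ`. -/
def topPowerDensity {n : ℕ} (H : Matrix (Fin n) (Fin n) ℂ) : ℝ :=
  (∑ σ : Equiv.Perm (Fin n), ∑ τ : Equiv.Perm (Fin n),
    ((Equiv.Perm.sign σ : ℤ) : ℂ) * ((Equiv.Perm.sign τ : ℤ) : ℂ) *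
      ∏ a, H (σ a) (τ a)).re / Real.pi ^ n

section Adjoint

variable {n : ℕ} {X : Type*} [TopologicalSpace X] [ChartedSpace (Fin n → ℂ) X]
  (L : X → Type*) [TopologicalSpace (Bundle.TotalSpace ℂ L)] [∀ x, TopologicalSpace (L x)]
  [∀ x, AddCommGroup (L x)] [∀ x, Module ℂ (L x)] [FiberBundle ℂ L] [VectorBundle ℂ ℂ L]
  (A : X → Type*) [TopologicalSpace (Bundle.TotalSpace ℂ A)] [∀ x, TopologicalSpace (A x)]
  [∀ x, AddCommGroup (A x)] [∀ x, Module ℂ (A x)] [FiberBundle ℂ A] [VectorBundle ℂ ℂ A]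
  (k m : ℕ)

/-- The fibre at `x` of `L^k ⊗ A^m ⊗ K_X`, where `K_X` is the bundle of complex alternating
`n`-forms on the holomorphic tangent spaces. -/
abbrev AdjFibre (x : X) : Type _ :=
  ((⨂[ℂ]^k (L x)) ⊗[ℂ] (⨂[ℂ]^m (A x))) ⊗[ℂ]
    ((TangentSpace 𝓘(ℂ, Fin n → ℂ) x) [⋀^Fin n]→ₗ[ℂ] ℂ)

/-- The coordinate on the `k`-th tensor power of the fibre `L_x` with respect to `e^{⊗k}`, where
`e` is the preferred frame at `p`. -/
def powCoeff (p x : X) : (⨂[ℂ]^k (L x)) →ₗ[ℂ] ℂ :=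
  PiTensorProduct.lift ((MultilinearMap.mkPiAlgebra ℂ (Fin k) ℂ).compLinearMap
    fun _ => (trivializationAt ℂ L p).linearMapAt ℂ x)

/-- The coordinate of an `n`-form with respect to `dz_1 ∧ ⋯ ∧ dz_n`. -/
def canCoeff (p : X) (z : Fin n → ℂ) :
    ((TangentSpace 𝓘(ℂ, Fin n → ℂ) (pt p z)) [⋀^Fin n]→ₗ[ℂ] ℂ) →ₗ[ℂ] ℂ where
  toFun α := α (coordVec p z)
  map_add' _ _ := rfl
  map_smul' _ _ := rfl

/-- The coordinate `f` of an element `f · e_L^k ⊗ e_A^m ⊗ dz_1 ∧ ⋯ ∧ dz_n` of the fibre of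
`L^k ⊗ A^m ⊗ K_X`, with respect to the preferred frames and coordinates at `p`. -/
def coeff (p : X) (z : Fin n → ℂ) : AdjFibre (n := n) L A k m (pt p z) →ₗ[ℂ] ℂ :=
  LinearMap.mul' ℂ ℂ ∘ₗ TensorProduct.map
    (LinearMap.mul' ℂ ℂ ∘ₗ TensorProduct.map (powCoeff L k p (pt p z)) (powCoeff A m p (pt p z)))
    (canCoeff p z)

/-- An open neighbourhood of `p` that carries the preferred coordinates and both preferred frames
at `p`. -/
def adjNhd (p : X) : Set X := frameNhd (n := n) L p ∩ frameNhd (n := n) A p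

/-- `H⁰(X, L^k ⊗ A^m ⊗ K_X)`: the sections whose coordinates in the local holomorphic frames are
holomorphic functions. -/
def H0 : Submodule ℂ (∀ x, AdjFibre (n := n) L A k m x) where
  carrier := {s | ∀ p : X, DifferentiableOn ℂ
    (fun z : Fin n → ℂ => coeff L A k m p z (s (pt p z))) (coordSet p (adjNhd (n := n) L A p))}
  zero_mem' := fun _ =>
    (differentiableOn_const (c := (0 : ℂ))).congr fun _ _ => map_zero _
  add_mem' := fun {_ _} hs ht p =>
    ((hs p).add (ht p)).congr fun _ _ => map_add _ _ _
  smul_mem' := fun c _ hs p =>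
    ((hs p).const_smul c).congr fun z _ => (coeff L A k m p z).map_smul c _

variable {L A}

/-- The density, with respect to `dV` in the coordinates at `p`, of the `(n,n)`-form
`⟨s₁,s₂⟩_{h_L^k ⊗ h_A^m}`: for `s_j = f_j e_L^k ⊗ e_A^m ⊗ dz_1 ∧ ⋯ ∧ dz_n` it is
`f₁ f̄₂ |e_L|^{2k} |e_A|^{2m}`. -/
def pairing (hL : HermitianMetric (n := n) L) (hA : HermitianMetric (n := n) A)
    (s₁ s₂ : ∀ x, AdjFibre (n := n) L A k m x) (p : X) (z : Fin n → ℂ) : ℂ :=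
  coeff L A k m p z (s₁ (pt p z)) * conj (coeff L A k m p z (s₂ (pt p z))) *
    ((hL.frameNormSq p z ^ k * hA.frameNormSq p z ^ m : ℝ) : ℂ)

variable (L A)

set_option linter.unusedSectionVars false in
theorem exists_cover [CompactSpace X] :
    ∃ (N : ℕ) (c : Fin N → X), ∀ x, ∃ i, x ∈ adjNhd (n := n) L A (c i) := by
  have hopen : ∀ p : X, IsOpen (adjNhd (n := n) L A p) := fun p =>
    ((chartAt (Fin n → ℂ) p).open_source.inter (trivializationAt ℂ L p).open_baseSet).inter
      ((chartAt (Fin n → ℂ) p).open_source.inter (trivializationAt ℂ A p).open_baseSet)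
  have hmem : ∀ p : X, p ∈ adjNhd (n := n) L A p := fun p =>
    ⟨⟨mem_chart_source _ p, FiberBundle.mem_baseSet_trivializationAt' p⟩,
      ⟨mem_chart_source _ p, FiberBundle.mem_baseSet_trivializationAt' p⟩⟩
  obtain ⟨t, ht⟩ := isCompact_univ.elim_finite_subcover (adjNhd (n := n) L A) hopen
    (fun x _ => Set.mem_iUnion.2 ⟨x, hmem x⟩)
  refine ⟨t.card, fun i => (t.equivFin.symm i : X), fun x => ?_⟩
  obtain ⟨p, hp, hx⟩ := Set.mem_iUnion₂.1 (ht (Set.mem_univ x))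
  exact ⟨t.equivFin ⟨p, hp⟩, by simpa using hx⟩

/-- The number of members of a finite cover of `X` by coordinate neighbourhoods. -/
def coverCard [CompactSpace X] : ℕ := (exists_cover (n := n) L A).choose

/-- The centres of a finite cover of `X` by coordinate neighbourhoods. -/
def coverPt [CompactSpace X] : Fin (coverCard (n := n) L A) → X :=
  (exists_cover (n := n) L A).choose_spec.choose

/-- The disjoint pieces into which the finite cover decomposes `X`. -/
def coverPiece [CompactSpace X] (i : Fin (coverCard (n := n) L A)) : Set X :=
  adjNhd (n := n) L A (coverPt (n := n) L A i) \
    ⋃ j : {j // j < i}, adjNhd (n := n) L A (coverPt (n := n) L A j)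

/-- The integral over `X` of an `(n,n)`-form, given by its densities `η p` with respect to Lebesgue
measure in the coordinates at the points `p`: the sum of the integrals over the pieces of a
decomposition of `X` into Borel sets, each of which lies in a coordinate neighbourhood. (For an
`(n,n)`-form the result does not depend on the decomposition.) -/
def integralForm [CompactSpace X] (η : X → (Fin n → ℂ) → ℂ) : ℂ :=
  ∑ i, ∫ z in coordSet (coverPt (n := n) L A i) (coverPiece (n := n) L A i),
    η (coverPt (n := n) L A i) z

variable {L A k m}

/-- The Hilbert inner product `∫_X ⟨s₁,s₂⟩_{h_L^k ⊗ h_A^m}` on `H⁰(X, L^k ⊗ A^m ⊗ K_X)`. -/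
def hilb [CompactSpace X] (hL : HermitianMetric (n := n) L) (hA : HermitianMetric (n := n) A)
    (s₁ s₂ : H0 (n := n) L A k m) : ℂ :=
  integralForm L A (pairing k m hL hA s₁ s₂)

/-- `σ` is an orthonormal basis of `H⁰(X, L^k ⊗ A^m ⊗ K_X)` for the Hilbert inner product. -/
def IsOrthonormalBasis [CompactSpace X] (hL : HermitianMetric (n := n) L)
    (hA : HermitianMetric (n := n) A) {N : ℕ} (σ : Fin N → H0 (n := n) L A k m) : Prop :=
  (∀ i j, hilb hL hA (σ i) (σ j) = if i = j then 1 else 0) ∧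
    Submodule.span ℂ (Set.range σ) = ⊤

/-- The density, in the coordinates at `p`, of the `(n,n)`-form `∑ |σ_j|²_{h_L^k ⊗ h_A^m}`. For an
orthonormal basis `σ` this form is the Bergman measure. -/
def bergmanDensity (hL : HermitianMetric (n := n) L) (hA : HermitianMetric (n := n) A) {N : ℕ}
    (σ : Fin N → H0 (n := n) L A k m) (p : X) (z : Fin n → ℂ) : ℝ :=
  ∑ j, (pairing k m hL hA (σ j) (σ j) p z).re

end Adjoint

end AdjointBergman

end

/-!
The proof is a local comparison with a Gaussian model, in the spirit of Berndtsson's proof of the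
asymptotic Morse inequalities.

By the extremal characterization (`bergmanDensity_mul_le_of_forall`) it suffices to bound
`|s(z)|²` by the squared norm of `s` for each section `s`, in local coordinates near each of
finitely many points of the compact manifold. There `s` is a holomorphic function `f` with weight
`k (φ + ε ψ)`, where `φ` and `ψ` are the local weights of the two metrics. At a point `z` each weight
is the sum of its value, the real part of a holomorphic polynomial, the hermitian form given by the
curvature, and a cubic error (`exists_taylor_bound`,
`exists_holomorphic_polynomial_add_hermForm`). The holomorphic polynomial is absorbed in `f`.
Diagonalizing both curvature forms simultaneously, with eigenvalues `λ_j ≥ 0` and `1`, one applies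
the mean value property to `f²` on the polydisc of radius `R = log k / √k`, with the Gaussian weight
`exp (-k ∑ (λ_j + ε) |w_j|²)`, which is invariant under the circle action
(`sq_norm_mul_setIntegral_le_of_balanced`). The mass of the Gaussian on the polydisc is
`∏ π (1 - exp (-k (λ_j + ε) R²)) / (k (λ_j + ε))`, and
`1 - exp (-k (λ_j + ε) R²) ≥ 1 - exp (-ε (log k)²)` because `k R² = (log k)²` and `λ_j ≥ 0`, while
`∏ (λ_j + ε)` is, up to the Jacobian of the change of basis, the determinant of the curvature of
`L` plus `ε` times that of `A`. The cubic error contributes `O(k R³) (1 + ε)` to the exponent,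
which is the source of the functions `ρ_k` and `ρ'_k`; they are constant on `X` and equal. This is
`exists_local_bergman_estimate`.

Both sides of the estimate are densities of `(n,n)`-forms, so it can be transported between
coordinates (`bergmanDensity_transition`, `det_curvature_transition`). The space of sections is
finite-dimensional because the estimate uses only orthonormality: the size of an orthonormal system
is the total mass of its Bergman density, which is bounded by the integral of a continuous density
(`exists_card_bound`).
-/

noncomputable section

namespace AdjointBergman

/-! ### Linear algebra and Gaussian integrals -/

/-- A positive definite and a positive semidefinite hermitian form have a common orthogonal basis
(the columns of `P`), orthonormal for the former. The forms are `∑ H_{jk} v_j v̄_k`, hence the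
transpose on the left and the conjugate on the right. -/
theorem exists_simultaneous_diagonalization {n : ℕ} {Θ Ω : Matrix (Fin n) (Fin n) ℂ}
    (hΘ : Θ.PosSemidef) (hΩ : Ω.PosDef) :
    ∃ (P : Matrix (Fin n) (Fin n) ℂ) (l : Fin n → ℝ), (∀ j, 0 ≤ l j) ∧
      P.transpose * Ω * P.map conj = 1 ∧
      P.transpose * Θ * P.map conj = Matrix.diagonal fun j => (l j : ℂ) := by
  classical
  obtain ⟨R, hR, hR1⟩ : ∃ R : Matrix (Fin n) (Fin n) ℂ, IsUnit R ∧ R.conjTranspose * Ω * R = 1 := by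
    set U : Matrix (Fin n) (Fin n) ℂ := (hΩ.1.eigenvectorUnitary : Matrix (Fin n) (Fin n) ℂ) with hUd
    have hU : star U * U = 1 := Unitary.coe_star_mul_self _
    have hpos := hΩ.eigenvalues_pos
    have hs : Ω = U * Matrix.diagonal (fun j => (hΩ.1.eigenvalues j : ℂ)) * star U := by
      conv_lhs => rw [hΩ.1.spectral_theorem]
      rfl
    -- Scaling an orthonormal eigenbasis of `Ω` by the inverse square roots of the eigenvalues
    -- makes it orthonormal for `Ω`.
    set D : Matrix (Fin n) (Fin n) ℂ :=
      Matrix.diagonal fun j => (((Real.sqrt (hΩ.1.eigenvalues j))⁻¹ : ℝ) : ℂ) with hD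
    have hDs : D.conjTranspose = D := by
      rw [hD, Matrix.diagonal_conjTranspose]; congr 1; ext j; simp
    have key : (U * D).conjTranspose * Ω * (U * D) = 1 := by
      rw [Matrix.conjTranspose_mul, hDs, hs, ← Matrix.star_eq_conjTranspose]
      calc D * star U * (U * Matrix.diagonal (fun j => (hΩ.1.eigenvalues j : ℂ)) * star U) * (U * D)
          = D * (star U * U) * Matrix.diagonal (fun j => (hΩ.1.eigenvalues j : ℂ))
              * (star U * U) * D := by simp only [Matrix.mul_assoc]
        _ = 1 := by
          rw [hU, hD]
          simp only [mul_one, Matrix.diagonal_mul_diagonal]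
          rw [← Matrix.diagonal_one]
          congr 1; ext j
          have h1 : Real.sqrt (hΩ.1.eigenvalues j) ≠ 0 := (Real.sqrt_pos.2 (hpos j)).ne'
          have h2 := Real.mul_self_sqrt (hpos j).le
          rw [← Complex.ofReal_mul, ← Complex.ofReal_mul, ← Complex.ofReal_one]
          congr 1
          nth_rewrite 2 [← h2]
          field_simp
    refine ⟨U * D, ?_, key⟩
    exact IsUnit.of_mul_eq_one_right _ key
  have hT : (R.conjTranspose * Θ * R).PosSemidef := hΘ.conjTranspose_mul_mul_same R
  set V : Matrix (Fin n) (Fin n) ℂ := (hT.1.eigenvectorUnitary : Matrix (Fin n) (Fin n) ℂ) with hVd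
  have hV : star V * V = 1 := Unitary.coe_star_mul_self _
  have hs : R.conjTranspose * Θ * R =
      V * Matrix.diagonal (fun j => (hT.1.eigenvalues j : ℂ)) * star V := by
    conv_lhs => rw [hT.1.spectral_theorem]
    rfl
  refine ⟨(R * V).map conj, hT.1.eigenvalues, hT.eigenvalues_nonneg, ?_, ?_⟩
  all_goals
    have e1 : ((R * V).map conj).transpose = star V * R.conjTranspose := by
      rw [Matrix.star_eq_conjTranspose, ← Matrix.conjTranspose_mul]; rfl
    have e2 : ((R * V).map conj).map conj = R * V := by
      ext i j; exact Complex.conj_conj _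
    rw [e1, e2]
  · calc star V * R.conjTranspose * Ω * (R * V) = star V * (R.conjTranspose * Ω * R) * V := by
          simp only [Matrix.mul_assoc]
      _ = 1 := by rw [hR1, mul_one, hV]
  · calc star V * R.conjTranspose * Θ * (R * V) = star V * (R.conjTranspose * Θ * R) * V := by
          simp only [Matrix.mul_assoc]
      _ = (star V * V) * Matrix.diagonal (fun j => (hT.1.eigenvalues j : ℂ)) * (star V * V) := by
          refine (congrArg (fun Y => star V * Y * V) hs).trans ?_
          simp only [Matrix.mul_assoc]
      _ = _ := by rw [hV, one_mul, mul_one]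

theorem integral_closedBall_exp_neg_mul_sq {c R : ℝ} (hc : 0 < c) (hR : 0 ≤ R) :
    ∫ w in Metric.closedBall (0 : ℂ) R, Real.exp (-(c * ‖w‖ ^ 2)) =
      Real.pi * (1 - Real.exp (-(c * R ^ 2))) / c := by
  rw [← MeasureTheory.integral_indicator Metric.isClosed_closedBall.measurableSet,
    ← Complex.integral_comp_polarCoord_symm, polarCoord_target]
  have h1 : ∀ p ∈ Set.Ioi (0 : ℝ) ×ˢ Set.Ioo (-Real.pi) Real.pi,
      p.1 • (Metric.closedBall (0 : ℂ) R).indicator (fun w => Real.exp (-(c * ‖w‖ ^ 2)))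
        (Complex.polarCoord.symm p) =
      (Set.Ioc 0 R).indicator (fun r => r * Real.exp (-(c * r ^ 2))) p.1 * 1 := by
    rintro ⟨r, θ⟩ ⟨hr, -⟩
    have hr : 0 < r := hr
    have hn : ‖Complex.polarCoord.symm (r, θ)‖ = r := by
      rw [Complex.norm_polarCoord_symm, abs_of_pos hr]
    by_cases h : r ≤ R
    · rw [Set.indicator_of_mem (by simpa [hn, abs_of_pos hr] using h),
        Set.indicator_of_mem (Set.mem_Ioc.2 ⟨hr, h⟩), hn]
      simp
    · rw [Set.indicator_of_notMem (by simpa [hn, abs_of_pos hr] using h),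
        Set.indicator_of_notMem (by simp [h])]
      simp
  rw [MeasureTheory.setIntegral_congr_fun (by measurability) h1,
    MeasureTheory.Measure.volume_eq_prod, MeasureTheory.setIntegral_prod_mul
      (fun r => (Set.Ioc 0 R).indicator (fun r => r * Real.exp (-(c * r ^ 2))) r) (fun _ => 1),
    MeasureTheory.setIntegral_indicator measurableSet_Ioc]
  have h2 : Set.Ioi (0 : ℝ) ∩ Set.Ioc 0 R = Set.Ioc 0 R := by
    ext x; simp only [Set.mem_inter_iff, Set.mem_Ioi, Set.mem_Ioc]; tauto
  rw [h2, ← intervalIntegral.integral_of_le hR]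
  have h3 : ∀ r ∈ Set.uIcc 0 R, HasDerivAt (fun r => -(1 / (2 * c)) * Real.exp (-(c * r ^ 2)))
      (r * Real.exp (-(c * r ^ 2))) r := by
    intro r _
    have := (((hasDerivAt_pow 2 r).const_mul c).neg.exp).const_mul (-(1 / (2 * c)))
    refine this.congr_deriv ?_
    simp only [Pi.neg_apply, Nat.cast_ofNat]
    field_simp
    simp
  rw [intervalIntegral.integral_eq_sub_of_hasDerivAt h3
    (Continuous.intervalIntegrable (by fun_prop) _ _)]
  simp
  rw [max_eq_left (by linarith [Real.pi_pos])]
  field_simp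
  ring

theorem integral_polydisc_exp_neg {n : ℕ} {c : Fin n → ℝ} {R : ℝ} (hc : ∀ j, 0 < c j)
    (hR : 0 ≤ R) :
    ∫ w in Metric.closedBall (0 : Fin n → ℂ) R, Real.exp (-∑ j, c j * ‖w j‖ ^ 2) =
      ∏ j, (Real.pi * (1 - Real.exp (-(c j * R ^ 2))) / c j) := by
  rw [closedBall_pi _ hR, MeasureTheory.volume_pi, MeasureTheory.Measure.restrict_pi_pi]
  simp_rw [← Finset.sum_neg_distrib, Real.exp_sum]
  rw [MeasureTheory.integral_fintype_prod_eq_prod (𝕜 := ℝ)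
    (fun j (w : ℂ) => Real.exp (-(c j * ‖w‖ ^ 2)))]
  exact Finset.prod_congr rfl fun j _ => integral_closedBall_exp_neg_mul_sq (hc j) hR

/-! ### Weighted mean value properties -/

/-- The mean value property along the complex line through `0` and `w`. -/
theorem circleAverage_ray {n : ℕ} {D V : Set (Fin n → ℂ)} (hV : IsOpen V) (hDV : D ⊆ V)
    (hD : ∀ c : ℂ, ‖c‖ ≤ 1 → ∀ w ∈ D, c • w ∈ D) {g : (Fin n → ℂ) → ℂ}
    (hg : DifferentiableOn ℂ g V) {w : Fin n → ℂ} (hw : w ∈ D) :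
    ∫ θ in (0 : ℝ)..2 * Real.pi, g (circleMap 0 1 θ • w) = (2 * Real.pi : ℝ) • g 0 := by
  have h1 : DiffContOnCl ℂ (fun c : ℂ => g (c • w)) (Metric.ball 0 |1|) := by
    apply DifferentiableOn.diffContOnCl
    rw [abs_one, closure_ball _ one_ne_zero]
    intro c hc
    have : DifferentiableAt ℂ g (c • w) :=
      (hg _ (hDV (hD c (by simpa using hc) w hw))).differentiableAt
        (hV.mem_nhds (hDV (hD c (by simpa using hc) w hw)))
    exact (this.comp c (by fun_prop)).differentiableWithinAt
  have h2 := h1.circleAverage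
  rw [Real.circleAverage_def] at h2
  simp only [zero_smul] at h2
  rw [← h2, smul_smul, mul_inv_cancel₀ (by positivity), one_smul]

/-- The mean value property of holomorphic functions, weighted by a function that is invariant
under the circle action, on a compact balanced set. -/
theorem setIntegral_holomorphic_mul_of_balanced {n : ℕ} {D V : Set (Fin n → ℂ)} (hDc : IsCompact D)
    (hV : IsOpen V) (hDV : D ⊆ V) (hD : ∀ c : ℂ, ‖c‖ ≤ 1 → ∀ w ∈ D, c • w ∈ D)
    {g : (Fin n → ℂ) → ℂ} (hg : DifferentiableOn ℂ g V) {ρ : (Fin n → ℂ) → ℝ}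
    (hρ : Continuous ρ) (hρc : ∀ (c : ℂ), ‖c‖ = 1 → ∀ w, ρ (c • w) = ρ w) :
    ∫ w in D, g w * ρ w = g 0 * ∫ w in D, (ρ w : ℂ) := by
  -- The integral does not change under rotation of `w`; averaging over the rotations and applying
  -- the mean value property on each complex line gives the value at `0`.
  have hrot : ∀ θ : ℝ, ∫ w in D, g (circleMap 0 1 θ • w) * ρ w = ∫ w in D, g w * ρ w := by
    intro θ
    set u := circleMap 0 1 θ
    have hu : ‖u‖ = 1 := by simp [u]
    have hu0 : u ≠ 0 := by intro h; simp [h] at hu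
    have hmp : MeasureTheory.MeasurePreserving (fun w : Fin n → ℂ => u • w) := by
      have : ∀ j : Fin n, MeasureTheory.MeasurePreserving (fun w : ℂ => u * w) := fun _ => by
        exact (rotation (⟨u, by simp [hu, Submonoid.unitSphere]⟩ : Circle)).measurePreserving
      exact MeasureTheory.volume_preserving_pi this
    have hpre : (fun w : Fin n → ℂ => u • w) ⁻¹' D = D := by
      ext w
      refine ⟨fun h => ?_, fun h => hD u hu.le w h⟩
      have := hD u⁻¹ (by simp [hu]) _ h
      simpa [smul_smul, hu0] using this
    have hemb : MeasurableEmbedding (fun w : Fin n → ℂ => u • w) :=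
      (Homeomorph.smulOfNeZero u hu0).measurableEmbedding
    have := hmp.setIntegral_preimage_emb hemb (fun w => g w * ρ w) D
    rw [hpre] at this
    rw [← this]
    refine MeasureTheory.integral_congr_ae (Filter.Eventually.of_forall fun w => ?_)
    exact congrArg (fun t : ℝ => g (u • w) * (t : ℂ)) (hρc u hu w).symm
  have hswap : ∫ θ in (0 : ℝ)..2 * Real.pi, ∫ w in D, g (circleMap 0 1 θ • w) * ρ w =
      ∫ w in D, ∫ θ in (0 : ℝ)..2 * Real.pi, g (circleMap 0 1 θ • w) * ρ w := by
    rw [intervalIntegral.integral_of_le (by positivity)]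
    rw [MeasureTheory.integral_integral_swap]
    · refine MeasureTheory.integral_congr_ae (Filter.Eventually.of_forall fun w => ?_)
      exact (intervalIntegral.integral_of_le (by positivity)).symm
    rw [MeasureTheory.Measure.prod_restrict]
    refine MeasureTheory.IntegrableOn.mono_set (t := Set.Icc 0 (2 * Real.pi) ×ˢ D) ?_
      (Set.prod_mono Set.Ioc_subset_Icc_self le_rfl)
    apply ContinuousOn.integrableOn_compact (isCompact_Icc.prod hDc)
    apply ContinuousOn.mul
    · refine hg.continuousOn.comp (by fun_prop) ?_
      rintro ⟨θ, w⟩ ⟨-, hw⟩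
      exact hDV (hD _ (by simp) w hw)
    · fun_prop
  simp_rw [hrot] at hswap
  rw [intervalIntegral.integral_const, sub_zero] at hswap
  have h3 : ∫ w in D, ∫ θ in (0 : ℝ)..2 * Real.pi, g (circleMap 0 1 θ • w) * ρ w =
      ∫ w in D, ((2 * Real.pi : ℝ) • g 0) * ρ w := by
    refine MeasureTheory.setIntegral_congr_fun hDc.measurableSet fun w hw => ?_
    rw [intervalIntegral.integral_mul_const, circleAverage_ray hV hDV hD hg hw]
  rw [h3, MeasureTheory.integral_const_mul, smul_mul_assoc] at hswap
  exact smul_right_injective ℂ (show (2 * Real.pi : ℝ) ≠ 0 by positivity) hswap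

/-- The sub-mean value inequality for `‖g‖²`, from the mean value property of the holomorphic
function `g²`. -/
theorem sq_norm_mul_setIntegral_le_of_balanced {n : ℕ} {D V : Set (Fin n → ℂ)} (hDc : IsCompact D)
    (hV : IsOpen V) (hDV : D ⊆ V) (hD : ∀ c : ℂ, ‖c‖ ≤ 1 → ∀ w ∈ D, c • w ∈ D)
    {g : (Fin n → ℂ) → ℂ} (hg : DifferentiableOn ℂ g V) {ρ : (Fin n → ℂ) → ℝ}
    (hρ : Continuous ρ) (hρ0 : ∀ w, 0 ≤ ρ w)
    (hρc : ∀ (c : ℂ), ‖c‖ = 1 → ∀ w, ρ (c • w) = ρ w) :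
    ‖g 0‖ ^ 2 * ∫ w in D, ρ w ≤ ∫ w in D, ‖g w‖ ^ 2 * ρ w := by
  have h := setIntegral_holomorphic_mul_of_balanced hDc hV hDV hD (hg.pow 2) hρ hρc
  calc ‖g 0‖ ^ 2 * ∫ w in D, ρ w = ‖∫ w in D, (g ^ 2) w * ρ w‖ := by
        rw [h, norm_mul, integral_complex_ofReal, Complex.norm_real, Real.norm_of_nonneg
          (MeasureTheory.integral_nonneg hρ0)]
        simp
    _ ≤ ∫ w in D, ‖(g ^ 2) w * ρ w‖ := MeasureTheory.norm_integral_le_integral_norm _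
    _ = _ := by
        congr 1; ext w
        rw [norm_mul, Complex.norm_real, Real.norm_of_nonneg (hρ0 w)]
        simp

/-! ### Second order expansion of the weights -/

/-- Taylor's formula of second order with a cubic remainder, uniformly on a compact convex set. Only
the upper bound is stated, as it is the one that the mean value inequality uses. -/
theorem exists_taylor_bound {E : Type*} [NormedAddCommGroup E] [NormedSpace ℝ E] {φ : E → ℝ}
    {U K : Set E} (hU : IsOpen U) (hφ : ContDiffOn ℝ ∞ φ U) (hK : IsCompact K)
    (hKc : Convex ℝ K) (hKU : K ⊆ U) :
    ∃ M, 0 ≤ M ∧ ∀ z v, z ∈ K → z + v ∈ K →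
      φ (z + v) ≤ φ z + fderiv ℝ φ z v + (1 / 2) * fderiv ℝ (fderiv ℝ φ) z v v + M * ‖v‖ ^ 3 := by
  have h1 : ContDiffOn ℝ ∞ (fderiv ℝ φ) U := hφ.fderiv_of_isOpen hU (by simp)
  have h2 : ContDiffOn ℝ ∞ (fderiv ℝ (fderiv ℝ φ)) U := h1.fderiv_of_isOpen hU (by simp)
  have d0 : ∀ x ∈ U, DifferentiableAt ℝ φ x := fun x hx =>
    (hφ.contDiffAt (hU.mem_nhds hx)).differentiableAt (by simp)
  have d1 : ∀ x ∈ U, DifferentiableAt ℝ (fderiv ℝ φ) x := fun x hx =>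
    (h1.contDiffAt (hU.mem_nhds hx)).differentiableAt (by simp)
  obtain ⟨M, hM⟩ := (h2.mono hKU).exists_lipschitzOnWith (by simp) hKc hK
  refine ⟨M, M.2, fun z v hz hv => ?_⟩
  have hseg : segment ℝ z (z + v) ⊆ K := hKc.segment_subset hz hv
  have hnorm : ∀ x ∈ segment ℝ z (z + v), ‖x - z‖ ≤ ‖v‖ := by
    intro x hx
    have := norm_sub_le_of_mem_segment hx
    simpa using this
  have hzs := left_mem_segment ℝ z (z + v)
  -- The second derivative is Lipschitz; two applications of the mean value inequality on the
  -- segment integrate this to the first derivative and to the function.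
  have e2 : ∀ x ∈ segment ℝ z (z + v),
      ‖fderiv ℝ (fderiv ℝ φ) x - fderiv ℝ (fderiv ℝ φ) z‖ ≤ (M : ℝ) * ‖v‖ := by
    intro x hx
    exact (hM.norm_sub_le (hseg hx) hz).trans (mul_le_mul_of_nonneg_left (hnorm x hx) M.2)
  have e1 : ∀ x ∈ segment ℝ z (z + v),
      ‖fderiv ℝ φ x - fderiv ℝ φ z - fderiv ℝ (fderiv ℝ φ) z (x - z)‖ ≤ (M : ℝ) * ‖v‖ ^ 2 := by
    intro x hx
    have hd : ∀ y ∈ segment ℝ z (z + v), HasFDerivWithinAt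
        (fun y => fderiv ℝ φ y - fderiv ℝ φ z - fderiv ℝ (fderiv ℝ φ) z (y - z))
        (fderiv ℝ (fderiv ℝ φ) y - fderiv ℝ (fderiv ℝ φ) z) (segment ℝ z (z + v)) y := by
      intro y hy
      have := (((d1 y (hKU (hseg hy))).hasFDerivAt.sub_const (fderiv ℝ φ z)).sub
        ((fderiv ℝ (fderiv ℝ φ) z).hasFDerivAt.comp y ((hasFDerivAt_id y).sub_const z)))
      exact this.hasFDerivWithinAt
    have := (convex_segment z (z + v)).norm_image_sub_le_of_norm_hasFDerivWithin_le hd e2 hzs hx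
    simp only [sub_self, map_zero, sub_zero] at this
    refine this.trans ?_
    calc (M : ℝ) * ‖v‖ * ‖x - z‖ ≤ (M : ℝ) * ‖v‖ * ‖v‖ := by gcongr; exact hnorm x hx
      _ = _ := by ring
  have hsymm : IsSymmSndFDerivAt ℝ φ z :=
    (hφ.contDiffAt (hU.mem_nhds (hKU hz))).isSymmSndFDerivAt (by simp; norm_cast)
  have hd : ∀ y ∈ segment ℝ z (z + v), HasFDerivWithinAt
      (fun y => φ y - φ z - fderiv ℝ φ z (y - z) -
        (1 / 2 : ℝ) * fderiv ℝ (fderiv ℝ φ) z (y - z) (y - z))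
      (fderiv ℝ φ y - fderiv ℝ φ z - fderiv ℝ (fderiv ℝ φ) z (y - z)) (segment ℝ z (z + v)) y := by
    intro y hy
    have hs : HasFDerivAt (fun y => y - z) (ContinuousLinearMap.id ℝ E) y :=
      (hasFDerivAt_id y).sub_const z
    have hB : HasFDerivAt (fun y => fderiv ℝ (fderiv ℝ φ) z (y - z) (y - z)) _ y :=
      ((fderiv ℝ (fderiv ℝ φ) z).hasFDerivAt.comp y hs).clm_apply hs
    have := ((((d0 y (hKU (hseg hy))).hasFDerivAt.sub_const (φ z)).sub
        ((fderiv ℝ φ z).hasFDerivAt.comp y hs)).sub (hB.const_mul (1 / 2 : ℝ)))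
    refine (this.congr_fderiv ?_).hasFDerivWithinAt
    ext u
    have hu := hsymm.eq u (y - z)
    simp only [sub_apply, add_apply, smul_apply, smul_eq_mul,
      ContinuousLinearMap.comp_apply, ContinuousLinearMap.flip_apply, Function.comp_apply,
      ContinuousLinearMap.id_apply, hu]
    ring
  have := (convex_segment z (z + v)).norm_image_sub_le_of_norm_hasFDerivWithin_le hd e1 hzs
    (right_mem_segment ℝ z (z + v))
  simp only [sub_self, map_zero, sub_zero, add_sub_cancel_left, mul_zero] at this
  have h := (le_abs_self _).trans this
  have e : (M : ℝ) * ‖v‖ ^ 2 * ‖v‖ = (M : ℝ) * ‖v‖ ^ 3 := by ring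
  linarith

/-- The complex Hessian of a real bilinear form: the matrix of its part of type `(1,1)`. The factor
`1 / 4` is that of `∂²/∂z_j∂z̄_k`, so that for the second derivative of a function this is the matrix
of its mixed Wirtinger derivatives. -/
def leviPart {n : ℕ} (B : (Fin n → ℂ) →L[ℝ] (Fin n → ℂ) →L[ℝ] ℝ) : Matrix (Fin n) (Fin n) ℂ :=
  Matrix.of fun j k => (1 / 4) *
    (((B (Pi.single j 1) (Pi.single k 1) +
        B (Pi.single j Complex.I) (Pi.single k Complex.I) : ℝ) : ℂ)
      + Complex.I * ((B (Pi.single j 1) (Pi.single k Complex.I) -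
        B (Pi.single j Complex.I) (Pi.single k 1) : ℝ) : ℂ))

/-- The hermitian form `∑ H_{jk} v_j v̄_k`. -/
def hermForm {n : ℕ} (H : Matrix (Fin n) (Fin n) ℂ) (v : Fin n → ℂ) : ℝ :=
  (∑ j, ∑ k, v j * conj (v k) * H j k).re

theorem eq_sum_re_im {n : ℕ} (v : Fin n → ℂ) :
    v = ∑ j, ((v j).re • (Pi.single j 1 : Fin n → ℂ) +
      (v j).im • (Pi.single j Complex.I : Fin n → ℂ)) := by
  ext i
  simp [Finset.sum_apply, Finset.sum_add_distrib, Pi.single_apply]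

/-- A real polynomial of degree at most two without constant term is the sum of the real part of a
holomorphic polynomial and a hermitian form. -/
theorem exists_holomorphic_polynomial_add_hermForm {n : ℕ} (l : (Fin n → ℂ) →L[ℝ] ℝ)
    (B : (Fin n → ℂ) →L[ℝ] (Fin n → ℂ) →L[ℝ] ℝ) :
    ∃ Q : (Fin n → ℂ) → ℂ, Differentiable ℂ Q ∧ Q 0 = 0 ∧
      ∀ v, l v + (1 / 2) * B v v = 2 * (Q v).re + hermForm (leviPart B) v := by
  refine ⟨fun v => (1 / 2) *
    (∑ j, v j * (l (Pi.single j 1) - Complex.I * l (Pi.single j Complex.I)) +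
    ∑ j, ∑ k, v j * v k * ((1 / 4) *
    (((B (Pi.single j 1) (Pi.single k 1) -
        B (Pi.single j Complex.I) (Pi.single k Complex.I) : ℝ) : ℂ)
      - Complex.I * ((B (Pi.single j 1) (Pi.single k Complex.I) +
        B (Pi.single j Complex.I) (Pi.single k 1) : ℝ) : ℂ)))), by fun_prop, by simp, fun v => ?_⟩
  have hl : l v = ∑ j, ((v j).re * l (Pi.single j 1) + (v j).im * l (Pi.single j Complex.I)) := by
    conv_lhs => rw [eq_sum_re_im v]
    simp [map_sum]
  have hB : B v v = ∑ j, ∑ k, (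
      (v j).re * (v k).re * B (Pi.single j 1) (Pi.single k 1) +
      (v j).re * (v k).im * B (Pi.single j 1) (Pi.single k Complex.I) +
      (v j).im * (v k).re * B (Pi.single j Complex.I) (Pi.single k 1) +
      (v j).im * (v k).im * B (Pi.single j Complex.I) (Pi.single k Complex.I)) := by
    have h2 : ∀ u, B u v = ∑ k, ((v k).re * B u (Pi.single k 1) +
        (v k).im * B u (Pi.single k Complex.I)) := by
      intro u
      conv_lhs => rw [eq_sum_re_im v]
      simp [map_sum]
    have h1 : B v = ∑ j, ((v j).re • B (Pi.single j 1) + (v j).im • B (Pi.single j Complex.I)) := by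
      conv_lhs => rw [eq_sum_re_im v]
      simp [map_sum]
    rw [h2 v]
    simp only [h1, sum_apply, add_apply, smul_apply, smul_eq_mul, Finset.mul_sum]
    simp only [← Finset.sum_add_distrib]
    rw [Finset.sum_comm]
    refine Finset.sum_congr rfl fun j _ => Finset.sum_congr rfl fun k _ => by ring
  rw [hl, hB, hermForm]
  have e : ∀ x : ℂ, 2 * ((1 / 2 : ℂ) * x).re = x.re := by intro x; simp
  rw [e, Complex.add_re, Complex.re_sum, Complex.re_sum, Complex.re_sum, add_assoc,
    Finset.mul_sum, ← Finset.sum_add_distrib (f := fun j => (∑ k, _ : ℂ).re)]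
  congr 1
  · refine Finset.sum_congr rfl fun j _ => ?_
    simp
  · refine Finset.sum_congr rfl fun j _ => ?_
    rw [Complex.re_sum, Complex.re_sum, Finset.mul_sum, ← Finset.sum_add_distrib]
    refine Finset.sum_congr rfl fun k _ => ?_
    simp [leviPart]
    ring

/-- The complex Hessian `(∂²φ/∂z_j∂z̄_k)`. For the local weight of a hermitian metric it is the
curvature matrix by definition. -/
def leviMatrix {n : ℕ} (φ : (Fin n → ℂ) → ℝ) (z : Fin n → ℂ) : Matrix (Fin n) (Fin n) ℂ :=
  Matrix.of fun j k => dz j (dzbar k fun w => (φ w : ℂ)) z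

theorem leviMatrix_eq_leviPart {n : ℕ} {φ : (Fin n → ℂ) → ℝ} {z : Fin n → ℂ}
    (hφ : ContDiffAt ℝ ∞ φ z) : leviMatrix φ z = leviPart (fderiv ℝ (fderiv ℝ φ) z) := by
  have h1 : DifferentiableAt ℝ (fderiv ℝ φ) z :=
    (hφ.fderiv_right (m := 1) (by norm_cast)).differentiableAt (by simp)
  have hev : ∀ᶠ w in nhds z, DifferentiableAt ℝ φ w := by
    filter_upwards [(hφ.of_le (m := 1) (by norm_cast)).eventually (by simp)] with w hw
    exact hw.differentiableAt (by simp)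
  ext j k
  have hbar : (dzbar k fun w => (φ w : ℂ)) =ᶠ[nhds z] fun w => (1 / 2) *
      ((fderiv ℝ φ w (Pi.single k 1) : ℝ) +
        Complex.I * (fderiv ℝ φ w (Pi.single k Complex.I) : ℝ)) := by
    filter_upwards [hev] with w hw
    have : fderiv ℝ (fun w => (φ w : ℂ)) w = Complex.ofRealCLM.comp (fderiv ℝ φ w) :=
      (Complex.ofRealCLM.hasFDerivAt.comp w hw.hasFDerivAt).fderiv
    simp [dzbar, this]
  have hd : ∀ u : Fin n → ℂ, HasFDerivAt (fun w => ((fderiv ℝ φ w u : ℝ) : ℂ))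
      (Complex.ofRealCLM.comp ((fderiv ℝ (fderiv ℝ φ) z).flip u)) z := by
    intro u
    have := h1.hasFDerivAt.clm_apply (hasFDerivAt_const u z)
    refine (Complex.ofRealCLM.hasFDerivAt.comp z this).congr_fderiv ?_
    ext v; simp
  have hD := ((hd (Pi.single k 1)).add
    ((hd (Pi.single k Complex.I)).const_mul Complex.I)).const_mul (1 / 2 : ℂ)
  have := (hD.congr_of_eventuallyEq hbar).fderiv
  simp only [leviMatrix, leviPart, Matrix.of_apply, dz]
  rw [this]
  simp
  linear_combination (-(1 / 4 : ℂ) * (fderiv ℝ (fderiv ℝ φ) z (Pi.single j Complex.I)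
    (Pi.single k Complex.I) : ℝ)) * Complex.I_sq

theorem leviMatrix_continuousOn {n : ℕ} {φ : (Fin n → ℂ) → ℝ} {U : Set (Fin n → ℂ)}
    (hU : IsOpen U) (hφ : ContDiffOn ℝ ∞ φ U) : ContinuousOn (leviMatrix φ) U := by
  have h1 : ContDiffOn ℝ ∞ (fderiv ℝ φ) U := hφ.fderiv_of_isOpen hU (by simp)
  have h2 : ContDiffOn ℝ ∞ (fderiv ℝ (fderiv ℝ φ)) U := h1.fderiv_of_isOpen hU (by simp)
  have h3 := h2.continuousOn
  have : ContinuousOn (fun z => leviPart (fderiv ℝ (fderiv ℝ φ) z)) U := by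
    have : ∀ u v, ContinuousOn (fun z => fderiv ℝ (fderiv ℝ φ) z u v) U := fun u v =>
      (h3.clm_apply continuousOn_const).clm_apply continuousOn_const
    refine continuousOn_pi.2 fun j => continuousOn_pi.2 fun k => ?_
    simp only [leviPart, Matrix.of_apply]
    refine continuousOn_const.mul (ContinuousOn.add ?_ (continuousOn_const.mul ?_))
    · exact Complex.continuous_ofReal.comp_continuousOn ((this _ _).add (this _ _))
    · exact Complex.continuous_ofReal.comp_continuousOn ((this _ _).sub (this _ _))
  exact this.congr fun z hz => leviMatrix_eq_leviPart (hφ.contDiffAt (hU.mem_nhds hz))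

/-- A continuous family of positive definite forms over a compact set is uniformly positive. -/
theorem exists_pos_le_hermForm {n : ℕ} {K : Set (Fin n → ℂ)} (hK : IsCompact K)
    {H : (Fin n → ℂ) → Matrix (Fin n) (Fin n) ℂ} (hH : ContinuousOn H K)
    (hpos : ∀ z ∈ K, (H z).PosDef) : ∃ c, 0 < c ∧ ∀ z ∈ K, ∀ v, c * ‖v‖ ^ 2 ≤ hermForm (H z) v := by
  have hsmul : ∀ (H : Matrix (Fin n) (Fin n) ℂ) (t : ℝ) (v : Fin n → ℂ),
      hermForm H ((t : ℂ) • v) = t ^ 2 * hermForm H v := by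
    intro H t v
    rw [hermForm, hermForm, ← Complex.re_ofReal_mul, Finset.mul_sum]
    congr 1
    refine Finset.sum_congr rfl fun j _ => ?_
    rw [Finset.mul_sum]
    refine Finset.sum_congr rfl fun k _ => ?_
    simp; ring
  have hp : ∀ z ∈ K, ∀ v, v ≠ 0 → 0 < hermForm (H z) v := by
    intro z hz v hv
    have := (hpos z hz).re_dotProduct_pos (x := star v) (by simpa using hv)
    convert this using 1
    simp only [hermForm, dotProduct, Matrix.mulVec, star_star, Finset.mul_sum]
    simp only [RCLike.re_eq_complex_re]
    congr 1
    refine Finset.sum_congr rfl fun j _ => Finset.sum_congr rfl fun k _ => ?_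
    simp; ring
  have hcont : ContinuousOn (fun p : (Fin n → ℂ) × (Fin n → ℂ) => hermForm (H p.1) p.2)
      (K ×ˢ Metric.sphere 0 1) := by
    unfold hermForm
    have hH' : ∀ j k, ContinuousOn (fun p : (Fin n → ℂ) × (Fin n → ℂ) => H p.1 j k)
        (K ×ˢ Metric.sphere 0 1) := fun j k =>
      ((continuous_apply_apply j k).comp_continuousOn hH).comp continuousOn_fst
        fun p hp => hp.1
    refine Complex.continuous_re.comp_continuousOn (continuousOn_finsetSum _ fun j _ =>
      continuousOn_finsetSum _ fun k _ => ContinuousOn.mul ?_ (hH' j k))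
    fun_prop
  have hcpt : IsCompact (K ×ˢ Metric.sphere (0 : Fin n → ℂ) 1) := hK.prod (isCompact_sphere _ _)
  have : ∃ c, 0 < c ∧ ∀ p ∈ K ×ˢ Metric.sphere (0 : Fin n → ℂ) 1, c ≤ hermForm (H p.1) p.2 := by
    rcases (K ×ˢ Metric.sphere (0 : Fin n → ℂ) 1).eq_empty_or_nonempty with h | h
    · exact ⟨1, one_pos, by simp [h]⟩
    · obtain ⟨p, hp1, hp2⟩ := hcpt.exists_isMinOn h hcont
      refine ⟨hermForm (H p.1) p.2, hp _ hp1.1 _ ?_, fun q hq => hp2 hq⟩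
      intro h0
      have := hp1.2
      simp [h0] at this
  obtain ⟨c, hc, hcK⟩ := this
  refine ⟨c, hc, fun z hz v => ?_⟩
  by_cases hv : v = 0
  · simp [hv, hermForm]
  have hv' : ‖v‖ ≠ 0 := by simpa using hv
  have h1 := hcK (z, ((‖v‖⁻¹ : ℝ) : ℂ) • v) ⟨hz, by
    simp [norm_smul, hv']⟩
  rw [hsmul] at h1
  rw [inv_pow] at h1
  have : 0 < ‖v‖ ^ 2 := by positivity
  rwa [inv_mul_eq_div, le_div_iff₀ this] at h1

theorem det_restrictScalars_eq_norm_sq {n : ℕ} (T : (Fin n → ℂ) →L[ℂ] (Fin n → ℂ)) :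
    (T.restrictScalars ℝ).det = ‖T.det‖ ^ 2 := by
  rw [ContinuousLinearMap.det, ContinuousLinearMap.coe_restrictScalars,
    LinearMap.det_restrictScalars, ContinuousLinearMap.det, Algebra.norm_complex_apply,
    Complex.normSq_eq_norm_sq]

/-! ### The local Bergman kernel estimate -/

theorem hermForm_mulVec {n : ℕ} {H P : Matrix (Fin n) (Fin n) ℂ} {l : Fin n → ℝ}
    (h : P.transpose * H * P.map conj = Matrix.diagonal fun j => (l j : ℂ)) (w : Fin n → ℂ) :
    hermForm H (P.mulVec w) = ∑ j, l j * ‖w j‖ ^ 2 := by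
  have h1 : ∀ v : Fin n → ℂ, hermForm H v = (v ⬝ᵥ H.mulVec (fun k => conj (v k))).re := by
    intro v
    simp only [hermForm, dotProduct, Matrix.mulVec, Finset.mul_sum]
    congr 1
    exact Finset.sum_congr rfl fun j _ => Finset.sum_congr rfl fun k _ => by ring
  have h2 : (fun k => conj (P.mulVec w k)) = (P.map conj).mulVec (fun k => conj (w k)) := by
    ext k; simp [Matrix.mulVec, dotProduct]
  have h3 : P.mulVec w ⬝ᵥ H.mulVec ((P.map conj).mulVec fun k => conj (w k)) =
      w ⬝ᵥ (P.transpose * H * P.map conj).mulVec (fun k => conj (w k)) := by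
    rw [← Matrix.mulVec_mulVec, ← Matrix.mulVec_mulVec, Matrix.dotProduct_mulVec w P.transpose,
      Matrix.vecMul_transpose]
  rw [h1, h2, h3, h]
  simp only [Matrix.mulVec_diagonal, dotProduct, Complex.re_sum]
  refine Finset.sum_congr rfl fun j _ => ?_
  have : w j * (l j * conj (w j)) = ((l j * ‖w j‖ ^ 2 : ℝ) : ℂ) := by
    rw [mul_left_comm, Complex.mul_conj, Complex.normSq_eq_norm_sq]; push_cast; ring
  rw [this, Complex.ofReal_re]

theorem sq_norm_det_mul_det_re {n : ℕ} {Θ Ω P : Matrix (Fin n) (Fin n) ℂ} {l : Fin n → ℝ}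
    (hΩ : P.transpose * Ω * P.map conj = 1)
    (hΘ : P.transpose * Θ * P.map conj = Matrix.diagonal fun j => (l j : ℂ)) (ε : ℝ) :
    ‖P.det‖ ^ 2 * ((Θ + (ε : ℂ) • Ω).det).re = ∏ j, (l j + ε) := by
  have h1 : P.transpose * (Θ + (ε : ℂ) • Ω) * P.map conj =
      Matrix.diagonal fun j => ((l j + ε : ℝ) : ℂ) := by
    rw [Matrix.mul_add, Matrix.add_mul, hΘ, Matrix.mul_smul, Matrix.smul_mul, hΩ,
      ← Matrix.diagonal_one, ← Matrix.diagonal_smul, Matrix.diagonal_add]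
    congr 1; ext j; simp
  have h2 := congrArg Matrix.det h1
  rw [Matrix.det_mul, Matrix.det_mul, Matrix.det_transpose, Matrix.det_diagonal] at h2
  have h3 : (P.map conj).det = conj P.det := (RingHom.map_det conj P).symm
  rw [h3, mul_right_comm, Complex.mul_conj, Complex.normSq_eq_norm_sq] at h2
  have h4 := congrArg Complex.re h2
  rwa [Complex.re_ofReal_mul, ← Complex.ofReal_prod, Complex.ofReal_re] at h4

theorem setIntegral_image_affine {n : ℕ} {P : Matrix (Fin n) (Fin n) ℂ} (hP : P.det ≠ 0)
    (z : Fin n → ℂ) {D : Set (Fin n → ℂ)} (hD : MeasurableSet D) (F : (Fin n → ℂ) → ℝ) :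
    ∫ y in (fun w => z + P.mulVec w) '' D, F y = ‖P.det‖ ^ 2 * ∫ w in D, F (z + P.mulVec w) := by
  set T : (Fin n → ℂ) →L[ℂ] (Fin n → ℂ) := LinearMap.toContinuousLinearMap P.mulVecLin with hT
  have hTd : T.det = P.det := by
    rw [ContinuousLinearMap.det, hT, LinearMap.coe_toContinuousLinearMap, ← Matrix.toLin'_apply',
      LinearMap.det_toLin']
  have hinj : Set.InjOn (fun w => z + P.mulVec w) D := by
    intro a _ b _ hab
    have := add_left_cancel hab
    exact Matrix.mulVec_injective_of_isUnit ((Matrix.isUnit_iff_isUnit_det _).2 hP.isUnit) this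
  have hder : ∀ w ∈ D, HasFDerivWithinAt (fun w => z + P.mulVec w) (T.restrictScalars ℝ) D w :=
    fun w _ => ((T.restrictScalars ℝ).hasFDerivAt.const_add z).hasFDerivWithinAt
  rw [MeasureTheory.integral_image_eq_integral_abs_det_fderiv_smul MeasureTheory.volume hD
    hder hinj, ← MeasureTheory.integral_const_mul]
  simp only [det_restrictScalars_eq_norm_sq, hTd, abs_of_nonneg (sq_nonneg ‖P.det‖), smul_eq_mul]

/-- The determinant times the Gaussian mass of the polydisc of radius `R`. The directions in which
the semipositive form is degenerate still have curvature `ε`, which is why the lower bound depends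
only on `ε`. -/
theorem le_prod_gaussian_disc {n : ℕ} {l : Fin n → ℝ} (hl : ∀ j, 0 ≤ l j) {ε k R : ℝ} (hε : 0 < ε)
    (hk : 0 < k) :
    (Real.pi * (1 - Real.exp (-(ε * (k * R ^ 2))))) ^ n ≤
      k ^ n * (∏ j, (l j + ε)) *
        ∏ j, (Real.pi * (1 - Real.exp (-(k * (l j + ε) * R ^ 2))) / (k * (l j + ε))) := by
  have e : k ^ n = ∏ _j : Fin n, k := by simp
  have e' : ∀ x : ℝ, x ^ n = ∏ _j : Fin n, x := by simp
  rw [e, ← Finset.prod_mul_distrib, ← Finset.prod_mul_distrib, e']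
  refine Finset.prod_le_prod (fun j _ => ?_) (fun j _ => ?_)
  · have : Real.exp (-(ε * (k * R ^ 2))) ≤ 1 := Real.exp_le_one_iff.2 (by
      have : 0 ≤ ε * (k * R ^ 2) := by positivity
      linarith)
    exact mul_nonneg Real.pi_pos.le (by linarith)
  · have h1 : 0 < k * (l j + ε) := mul_pos hk (by linarith [hl j])
    rw [mul_div_cancel₀ _ h1.ne']
    refine mul_le_mul_of_nonneg_left ?_ Real.pi_pos.le
    have : Real.exp (-(k * (l j + ε) * R ^ 2)) ≤ Real.exp (-(ε * (k * R ^ 2))) := by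
      apply Real.exp_le_exp.2
      have : 0 ≤ k * l j * R ^ 2 := mul_nonneg (mul_nonneg hk.le (hl j)) (sq_nonneg _)
      nlinarith
    linarith

/-- The radius `log k / √k` of the polydiscs on which the mean value inequality is used. It is large
enough for `k R² = (log k)²` to tend to infinity, which controls the truncation of the Gaussian, and
small enough for `k R³` to tend to `0`, which controls the cubic Taylor error. -/
def radius (k : ℕ) : ℝ := Real.log k / Real.sqrt k

theorem radius_nonneg (k : ℕ) : 0 ≤ radius k :=
  div_nonneg (Real.log_natCast_nonneg k) (Real.sqrt_nonneg _)

theorem mul_radius_sq {k : ℕ} (hk : k ≠ 0) : (k : ℝ) * radius k ^ 2 = Real.log k ^ 2 := by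
  have : (0 : ℝ) < k := by positivity
  rw [radius, div_pow, Real.sq_sqrt this.le]
  field_simp

theorem tendsto_radius : Filter.Tendsto radius Filter.atTop (nhds 0) := by
  have h := (isLittleO_log_rpow_atTop (r := 1 / 2) (by norm_num)).tendsto_div_nhds_zero.comp
    (tendsto_natCast_atTop_atTop (R := ℝ))
  refine h.congr fun k => ?_
  simp [radius, Real.sqrt_eq_rpow]

theorem tendsto_mul_radius_cube :
    Filter.Tendsto (fun k : ℕ => (k : ℝ) * radius k ^ 3) Filter.atTop (nhds 0) := by
  have h := (isLittleO_log_rpow_atTop (r := 1 / 6) (by norm_num)).tendsto_div_nhds_zero.comp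
    (tendsto_natCast_atTop_atTop (R := ℝ))
  have h3 := h.pow 3
  rw [zero_pow (by norm_num)] at h3
  refine h3.congr' ?_
  filter_upwards [Filter.eventually_gt_atTop 0] with k hk
  have hk' : (0 : ℝ) < k := by exact_mod_cast hk
  have e : ((k : ℝ) ^ (1 / 6 : ℝ)) ^ 3 = Real.sqrt k := by
    rw [Real.sqrt_eq_rpow, ← Real.rpow_natCast, ← Real.rpow_mul hk'.le]; norm_num
  have hs : Real.sqrt k ≠ 0 := (Real.sqrt_pos.2 hk').ne'
  simp only [Function.comp_apply, radius, div_pow]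
  rw [e]
  have : (Real.sqrt k) ^ 2 = k := Real.sq_sqrt hk'.le
  field_simp
  rw [this]

/-- The local form of the Bergman kernel estimate. Near `z₀` the weights `φ` and `ψ` are replaced by
their quadratic models up to a cubic error, the pluriharmonic part being absorbed in the
holomorphic function; the mean value inequality on a polydisc adapted to the simultaneous
diagonalization of the complex Hessians then gives the constant of the model. -/
theorem exists_local_bergman_estimate {n : ℕ} {U : Set (Fin n → ℂ)} (hU : IsOpen U)
    {φ ψ : (Fin n → ℂ) → ℝ} (hφ : ContDiffOn ℝ ∞ φ U) (hψ : ContDiffOn ℝ ∞ ψ U)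
    (hφ0 : ∀ z ∈ U, (leviMatrix φ z).PosSemidef) (hψ0 : ∀ z ∈ U, (leviMatrix ψ z).PosDef)
    {z₀ : Fin n → ℂ} (hz₀ : z₀ ∈ U) :
    ∃ r > 0, Metric.closedBall z₀ r ⊆ U ∧ ∃ (δ : ℕ → ℝ) (k₀ : ℕ),
      Filter.Tendsto δ Filter.atTop (nhds 0) ∧ 2 ≤ k₀ ∧
      ∀ k : ℕ, k₀ ≤ k → ∀ ε : ℝ, 0 < ε → ∀ z ∈ Metric.closedBall z₀ (r / 2),
      ∀ f : (Fin n → ℂ) → ℂ, DifferentiableOn ℂ f U →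
        ‖f z‖ ^ 2 * Real.exp (-(k * (φ z + ε * ψ z))) *
            (Real.pi * (1 - Real.exp (-(ε * Real.log k ^ 2)))) ^ n ≤
          k ^ n * (leviMatrix φ z + (ε : ℂ) • leviMatrix ψ z).det.re *
            Real.exp (δ k + ε * δ k) *
            ∫ w in Metric.closedBall z₀ r, ‖f w‖ ^ 2 * Real.exp (-(k * (φ w + ε * ψ w))) := by
  obtain ⟨r, hr, hrU⟩ := Metric.nhds_basis_closedBall.mem_iff.1 (hU.mem_nhds hz₀)
  set K := Metric.closedBall z₀ r with hK
  have hKc : IsCompact K := isCompact_closedBall _ _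
  obtain ⟨M₁, hM₁, hT₁⟩ := exists_taylor_bound hU hφ hKc (convex_closedBall _ _) hrU
  obtain ⟨M₂, hM₂, hT₂⟩ := exists_taylor_bound hU hψ hKc (convex_closedBall _ _) hrU
  obtain ⟨c, hc, hcK⟩ := exists_pos_le_hermForm hKc ((leviMatrix_continuousOn hU hψ).mono hrU)
    fun z hz => hψ0 z (hrU hz)
  -- The polydisc of radius `R` in a basis that is orthonormal for the complex Hessian of `ψ` lies in
  -- a ball of radius `C R`.
  set C := Real.sqrt (n / c) with hC
  have hC0 : 0 ≤ C := Real.sqrt_nonneg _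
  set M := max M₁ M₂ with hM
  have hM0 : 0 ≤ M := hM₁.trans (le_max_left _ _)
  have hev : ∀ᶠ k : ℕ in Filter.atTop, C * radius k < r / 2 := by
    have : Filter.Tendsto (fun k => C * radius k) Filter.atTop (nhds 0) := by
      simpa using tendsto_radius.const_mul C
    exact this.eventually_lt_const (by positivity)
  obtain ⟨k₀, hk₀⟩ := Filter.eventually_atTop.1 hev
  refine ⟨r, hr, hrU, fun k => M * C ^ 3 * (k * radius k ^ 3), max k₀ 2, ?_, le_max_right _ _, ?_⟩
  · simpa using tendsto_mul_radius_cube.const_mul (M * C ^ 3)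
  intro k hk ε hε z hz f hf
  have hk2 : 2 ≤ k := (le_max_right _ _).trans hk
  have hkpos : (0 : ℝ) < k := by exact_mod_cast (show 0 < k by omega)
  have hkr : C * radius k < r / 2 := hk₀ k ((le_max_left _ _).trans hk)
  set R := radius k with hR
  have hR0 : 0 ≤ R := radius_nonneg k
  have hzK : z ∈ K := Metric.closedBall_subset_closedBall (by linarith) hz
  have hzU : z ∈ U := hrU hzK
  obtain ⟨P, l, hl, hPΩ, hPΘ⟩ := exists_simultaneous_diagonalization (hφ0 z hzU) (hψ0 z hzU)
  have hPdet : P.det ≠ 0 := by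
    have := congrArg Matrix.det hPΩ
    rw [Matrix.det_mul, Matrix.det_mul, Matrix.det_transpose, Matrix.det_one] at this
    intro h0; simp [h0] at this
  obtain ⟨Q₁, hQ₁, hQ₁0, hQ₁e⟩ := exists_holomorphic_polynomial_add_hermForm (fderiv ℝ φ z)
    (fderiv ℝ (fderiv ℝ φ) z)
  obtain ⟨Q₂, hQ₂, hQ₂0, hQ₂e⟩ := exists_holomorphic_polynomial_add_hermForm (fderiv ℝ ψ z)
    (fderiv ℝ (fderiv ℝ ψ) z)
  rw [← leviMatrix_eq_leviPart (hφ.contDiffAt (hU.mem_nhds hzU))] at hQ₁e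
  rw [← leviMatrix_eq_leviPart (hψ.contDiffAt (hU.mem_nhds hzU))] at hQ₂e
  have hPΩ' : P.transpose * leviMatrix ψ z * P.map conj =
      Matrix.diagonal fun _ => ((1 : ℝ) : ℂ) := by rw [hPΩ]; simp
  set D := Metric.closedBall (0 : Fin n → ℂ) R with hD
  have hDw : ∀ w ∈ D, ∀ j, ‖w j‖ ≤ R := fun w hw j =>
    (norm_le_pi_norm w j).trans (by simpa [hD] using hw)
  have hPn : ∀ w ∈ D, ‖P.mulVec w‖ ≤ C * R := by
    intro w hw
    have h1 := hcK z hzK (P.mulVec w)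
    rw [hermForm_mulVec hPΩ'] at h1
    have h2 : ∑ j : Fin n, (1 : ℝ) * ‖w j‖ ^ 2 ≤ n * R ^ 2 := by
      calc ∑ j : Fin n, (1 : ℝ) * ‖w j‖ ^ 2 ≤ ∑ _j : Fin n, R ^ 2 :=
            Finset.sum_le_sum fun j _ => by
              rw [one_mul]; exact pow_le_pow_left₀ (norm_nonneg _) (hDw w hw j) 2
        _ = _ := by simp
    have h3 : ‖P.mulVec w‖ ^ 2 ≤ (C * R) ^ 2 := by
      rw [mul_pow, hC, Real.sq_sqrt (by positivity), div_mul_eq_mul_div, le_div_iff₀ hc]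
      linarith
    exact (sq_le_sq₀ (norm_nonneg _) (by positivity)).1 h3
  have hzw : ∀ w ∈ D, z + P.mulVec w ∈ K := by
    intro w hw
    have h1 := hPn w hw
    have h2 : dist z z₀ ≤ r / 2 := hz
    have h3 : dist (z + P.mulVec w) z ≤ r / 2 := by
      rw [dist_eq_norm, add_sub_cancel_left]; linarith
    have := dist_triangle (z + P.mulVec w) z z₀
    rw [hK, Metric.mem_closedBall]; linarith
  have haff : Differentiable ℂ fun w : Fin n → ℂ => z + P.mulVec w :=
    (LinearMap.toContinuousLinearMap P.mulVecLin).differentiable.const_add z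
  have hlin : Differentiable ℂ fun w : Fin n → ℂ => P.mulVec w :=
    (LinearMap.toContinuousLinearMap P.mulVecLin).differentiable
  set V := (fun w : Fin n → ℂ => z + P.mulVec w) ⁻¹' U with hV
  have hVo : IsOpen V := hU.preimage haff.continuous
  -- The exponential factor removes the pluriharmonic part of the weight at `z`.
  set g : (Fin n → ℂ) → ℂ := fun w => f (z + P.mulVec w) *
    Complex.exp (-(k * (Q₁ (P.mulVec w) + ε * Q₂ (P.mulVec w)))) with hg
  have hgV : DifferentiableOn ℂ g V := by
    refine DifferentiableOn.mul (hf.comp haff.differentiableOn fun w hw => hw) ?_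
    have h1 := hQ₁.comp hlin
    have h2 := hQ₂.comp hlin
    exact ((((h1.add (h2.const_mul (ε : ℂ))).const_mul (k : ℂ)).neg).cexp).differentiableOn
  set ρ : (Fin n → ℂ) → ℝ := fun w => Real.exp (-∑ j, k * (l j + ε) * ‖w j‖ ^ 2) with hρ
  have hρc : Continuous ρ := by fun_prop
  have hmean := sq_norm_mul_setIntegral_le_of_balanced (D := D) (V := V)
    (isCompact_closedBall _ _) hVo (fun w hw => hrU (hzw w hw))
    (fun a ha w hw => by
      simp only [hD, mem_closedBall_zero_iff] at hw ⊢
      rw [norm_smul]; nlinarith [norm_nonneg w, norm_nonneg a]) hgV hρc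
    (fun w => (Real.exp_pos _).le) (fun a ha w => by simp [hρ, ha])
  have hg0 : g 0 = f z := by simp [hg, hQ₁0, hQ₂0]
  rw [hg0, integral_polydisc_exp_neg (fun j => mul_pos hkpos (by linarith [hl j])) hR0] at hmean
  set δ := M * C ^ 3 * (k * R ^ 3) with hδ
  set F : (Fin n → ℂ) → ℝ := fun w => ‖f w‖ ^ 2 * Real.exp (-(k * (φ w + ε * ψ w))) with hF
  have hFc : ContinuousOn F K := by
    have h1 := hf.continuousOn.mono hrU
    have h2 := hφ.continuousOn.mono hrU
    have h3 := hψ.continuousOn.mono hrU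
    fun_prop
  have hpt : ∀ w ∈ D, ‖g w‖ ^ 2 * ρ w ≤
      Real.exp (δ + ε * δ) * Real.exp (k * (φ z + ε * ψ z)) * F (z + P.mulVec w) := by
    intro w hw
    have t1 := hT₁ z (P.mulVec w) hzK (hzw w hw)
    have t2 := hT₂ z (P.mulVec w) hzK (hzw w hw)
    rw [add_assoc (φ z), hQ₁e, hermForm_mulVec hPΘ] at t1
    rw [add_assoc (ψ z), hQ₂e, hermForm_mulVec hPΩ'] at t2
    have hn3 : ‖P.mulVec w‖ ^ 3 ≤ (C * R) ^ 3 := pow_le_pow_left₀ (norm_nonneg _) (hPn w hw) 3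
    have b1 : M₁ * ‖P.mulVec w‖ ^ 3 ≤ M * (C * R) ^ 3 :=
      mul_le_mul (le_max_left _ _) hn3 (by positivity) hM0
    have b2 : M₂ * ‖P.mulVec w‖ ^ 3 ≤ M * (C * R) ^ 3 :=
      mul_le_mul (le_max_right _ _) hn3 (by positivity) hM0
    have hsum : ∑ j, k * (l j + ε) * ‖w j‖ ^ 2 =
        k * (∑ j, l j * ‖w j‖ ^ 2 + ε * ∑ j, 1 * ‖w j‖ ^ 2) := by
      rw [Finset.mul_sum, ← Finset.sum_add_distrib, Finset.mul_sum]
      exact Finset.sum_congr rfl fun j _ => by ring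
    have hnorm : ‖g w‖ ^ 2 = ‖f (z + P.mulVec w)‖ ^ 2 *
        Real.exp (-(k * (2 * (Q₁ (P.mulVec w)).re + ε * (2 * (Q₂ (P.mulVec w)).re)))) := by
      simp only [hg]
      rw [norm_mul, mul_pow, Complex.norm_exp, ← Real.exp_nat_mul]
      congr 2
      simp
      ring
    rw [hnorm, hF]
    simp only [hρ]
    rw [mul_assoc, ← Real.exp_add, ← Real.exp_add (δ + ε * δ), mul_left_comm (Real.exp _),
      ← Real.exp_add]
    refine mul_le_mul_of_nonneg_left (Real.exp_le_exp.2 ?_) (sq_nonneg _)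
    rw [hsum]
    have hδ' : δ = k * (M * (C * R) ^ 3) := by rw [hδ]; ring
    rw [hδ']
    have u1 := mul_le_mul_of_nonneg_left (t1.trans (add_le_add_right b1 _)) hkpos.le
    have u2 := mul_le_mul_of_nonneg_left (t2.trans (add_le_add_right b2 _)) (mul_pos hkpos hε).le
    nlinarith [u1, u2]
  have hint : ∫ w in D, ‖g w‖ ^ 2 * ρ w ≤
      Real.exp (δ + ε * δ) * Real.exp (k * (φ z + ε * ψ z)) *
        ∫ w in D, F (z + P.mulVec w) := by
    rw [← MeasureTheory.integral_const_mul]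
    refine MeasureTheory.setIntegral_mono_on ?_ ?_ (isCompact_closedBall _ _).measurableSet hpt
    · refine ContinuousOn.integrableOn_compact (isCompact_closedBall _ _) ?_
      have := hgV.continuousOn.mono (fun w (hw : w ∈ D) => hrU (hzw w hw))
      fun_prop
    · refine ContinuousOn.integrableOn_compact (isCompact_closedBall _ _) ?_
      exact continuousOn_const.mul (hFc.comp haff.continuous.continuousOn hzw)
  have hsub : (fun w => z + P.mulVec w) '' D ⊆ K := by
    rintro _ ⟨w, hw, rfl⟩
    exact hzw w hw
  have himg : ‖P.det‖ ^ 2 * ∫ w in D, F (z + P.mulVec w) ≤ ∫ y in K, F y := by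
    rw [← setIntegral_image_affine hPdet z (isCompact_closedBall _ _).measurableSet]
    refine MeasureTheory.setIntegral_mono_set (hFc.integrableOn_compact hKc)
      (Filter.Eventually.of_forall fun w => mul_nonneg (sq_nonneg _) (Real.exp_pos _).le)
      hsub.eventuallyLE
  have hprod := le_prod_gaussian_disc (R := R) hl hε hkpos
  rw [mul_radius_sq (by omega), ← sq_norm_det_mul_det_re hPΩ hPΘ ε] at hprod
  set G := ∏ j, (Real.pi * (1 - Real.exp (-(k * (l j + ε) * R ^ 2))) / (k * (l j + ε))) with hG
  set d := (leviMatrix φ z + (ε : ℂ) • leviMatrix ψ z).det.re with hd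
  have hd0 : 0 ≤ d := by
    have h1 := sq_norm_det_mul_det_re hPΩ hPΘ ε
    have h2 : 0 ≤ ∏ j, (l j + ε) := Finset.prod_nonneg fun j _ => by linarith [hl j]
    rw [← h1] at h2
    exact nonneg_of_mul_nonneg_right h2 (by positivity)
  have hE : 0 ≤ Real.exp (-(k * (φ z + ε * ψ z))) := (Real.exp_pos _).le
  calc ‖f z‖ ^ 2 * Real.exp (-(k * (φ z + ε * ψ z))) *
        (Real.pi * (1 - Real.exp (-(ε * Real.log k ^ 2)))) ^ n
      ≤ ‖f z‖ ^ 2 * Real.exp (-(k * (φ z + ε * ψ z))) * (k ^ n * (‖P.det‖ ^ 2 * d) * G) :=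
        mul_le_mul_of_nonneg_left hprod (mul_nonneg (sq_nonneg _) hE)
    _ = Real.exp (-(k * (φ z + ε * ψ z))) * (k ^ n * (‖P.det‖ ^ 2 * d)) * (‖f z‖ ^ 2 * G) := by ring
    _ ≤ Real.exp (-(k * (φ z + ε * ψ z))) * (k ^ n * (‖P.det‖ ^ 2 * d)) *
        (Real.exp (δ + ε * δ) * Real.exp (k * (φ z + ε * ψ z)) * ∫ w in D, F (z + P.mulVec w)) :=
        mul_le_mul_of_nonneg_left (hmean.trans hint) (by positivity)
    _ = (Real.exp (-(k * (φ z + ε * ψ z))) * Real.exp (k * (φ z + ε * ψ z))) *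
        (k ^ n * d * Real.exp (δ + ε * δ) * (‖P.det‖ ^ 2 * ∫ w in D, F (z + P.mulVec w))) := by ring
    _ = k ^ n * d * Real.exp (δ + ε * δ) * (‖P.det‖ ^ 2 * ∫ w in D, F (z + P.mulVec w)) := by
        rw [← Real.exp_add, neg_add_cancel, Real.exp_zero, one_mul]
    _ ≤ _ := mul_le_mul_of_nonneg_left himg (by positivity)

/-! ### Wirtinger derivatives and the complex Hessian under holomorphic maps -/

theorem fderiv_real_eq_sum_wirtinger {n : ℕ} (f : (Fin n → ℂ) → ℂ) (z v : Fin n → ℂ) :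
    fderiv ℝ f z v = ∑ j, (dz j f z * v j + dzbar j f z * conj (v j)) := by
  conv_lhs => rw [eq_sum_re_im v]
  rw [map_sum]
  refine Finset.sum_congr rfl fun j _ => ?_
  rw [map_add, map_smul, map_smul]
  simp only [dz, dzbar, Complex.real_smul]
  have h1 : conj (v j) = (v j).re - (v j).im * Complex.I := by
    apply Complex.ext <;> simp
  have h2 : v j = (v j).re + (v j).im * Complex.I := (Complex.re_add_im _).symm
  rw [h1]
  generalize fderiv ℝ f z (Pi.single j Complex.I) = b
  generalize fderiv ℝ f z (Pi.single j 1) = a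
  generalize (v j).re = x at *
  generalize (v j).im = y at *
  rw [h2]
  linear_combination (b * y : ℂ) * Complex.I_sq

theorem single_I {n : ℕ} (j : Fin n) :
    (Pi.single j Complex.I : Fin n → ℂ) = Complex.I • Pi.single j (1 : ℂ) := by
  ext i; simp [Pi.single_apply]

theorem fderiv_real_of_complex {n : ℕ} {E : Type*} [NormedAddCommGroup E] [NormedSpace ℂ E]
    {T : (Fin n → ℂ) → E} {z : Fin n → ℂ} (hT : DifferentiableAt ℂ T z) :
    HasFDerivAt T ((fderiv ℂ T z).restrictScalars ℝ) z :=
  hT.hasFDerivAt.restrictScalars ℝ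

theorem dz_comp_holomorphic {n : ℕ} {f : (Fin n → ℂ) → ℂ} {T : (Fin n → ℂ) → (Fin n → ℂ)}
    {z : Fin n → ℂ} (hf : DifferentiableAt ℝ f (T z)) (hT : DifferentiableAt ℂ T z) (j : Fin n) :
    dz j (fun w => f (T w)) z = ∑ l, dz l f (T z) * fderiv ℂ T z (Pi.single j 1) l := by
  have h : fderiv ℝ (fun w => f (T w)) z =
      (fderiv ℝ f (T z)).comp ((fderiv ℂ T z).restrictScalars ℝ) :=
    (hf.hasFDerivAt.comp z (fderiv_real_of_complex hT)).fderiv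
  conv_lhs => rw [dz, h]
  simp only [ContinuousLinearMap.comp_apply, ContinuousLinearMap.coe_restrictScalars',
    single_I, map_smul, fderiv_real_eq_sum_wirtinger f]
  rw [Finset.mul_sum, ← Finset.sum_sub_distrib, Finset.mul_sum]
  refine Finset.sum_congr rfl fun l _ => ?_
  simp only [Pi.smul_apply, smul_eq_mul, map_mul, Complex.conj_I]
  generalize fderiv ℂ T z (Pi.single j 1) l = t
  linear_combination (-(1 / 2) * (dz l f (T z) * t - dzbar l f (T z) * conj t)) * Complex.I_sq

theorem dzbar_comp_holomorphic {n : ℕ} {f : (Fin n → ℂ) → ℂ} {T : (Fin n → ℂ) → (Fin n → ℂ)}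
    {z : Fin n → ℂ} (hf : DifferentiableAt ℝ f (T z)) (hT : DifferentiableAt ℂ T z) (j : Fin n) :
    dzbar j (fun w => f (T w)) z =
      ∑ l, dzbar l f (T z) * conj (fderiv ℂ T z (Pi.single j 1) l) := by
  have h : fderiv ℝ (fun w => f (T w)) z =
      (fderiv ℝ f (T z)).comp ((fderiv ℂ T z).restrictScalars ℝ) :=
    (hf.hasFDerivAt.comp z (fderiv_real_of_complex hT)).fderiv
  conv_lhs => rw [dzbar, h]
  simp only [ContinuousLinearMap.comp_apply, ContinuousLinearMap.coe_restrictScalars',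
    single_I, map_smul, fderiv_real_eq_sum_wirtinger f]
  rw [Finset.mul_sum, ← Finset.sum_add_distrib, Finset.mul_sum]
  refine Finset.sum_congr rfl fun l _ => ?_
  simp only [Pi.smul_apply, smul_eq_mul, map_mul, Complex.conj_I]
  generalize fderiv ℂ T z (Pi.single j 1) l = t
  linear_combination ((1 / 2) * (dz l f (T z) * t - dzbar l f (T z) * conj t)) * Complex.I_sq

theorem dz_conj_holomorphic {n : ℕ} {h : (Fin n → ℂ) → ℂ} {z : Fin n → ℂ}
    (hh : DifferentiableAt ℂ h z) (j : Fin n) : dz j (fun w => conj (h w)) z = 0 := by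
  have : fderiv ℝ (fun w => conj (h w)) z =
      (Complex.conjCLE : ℂ →L[ℝ] ℂ).comp ((fderiv ℂ h z).restrictScalars ℝ) :=
    (Complex.conjCLE.hasFDerivAt.comp z (fderiv_real_of_complex hh)).fderiv
  rw [dz, this]
  simp only [ContinuousLinearMap.comp_apply, ContinuousLinearMap.coe_restrictScalars', single_I,
    map_smul, ContinuousLinearEquiv.coe_coe, Complex.conjCLE_apply, smul_eq_mul, map_mul,
    Complex.conj_I]
  linear_combination ((1 / 2) * conj (fderiv ℂ h z (Pi.single j 1))) * Complex.I_sq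

theorem dz_add {n : ℕ} {f g : (Fin n → ℂ) → ℂ} {z : Fin n → ℂ} (hf : DifferentiableAt ℝ f z)
    (hg : DifferentiableAt ℝ g z) (j : Fin n) :
    dz j (fun w => f w + g w) z = dz j f z + dz j g z := by
  simp only [dz, fderiv_fun_add hf hg, add_apply]; ring

theorem dzbar_add {n : ℕ} {f g : (Fin n → ℂ) → ℂ} {z : Fin n → ℂ} (hf : DifferentiableAt ℝ f z)
    (hg : DifferentiableAt ℝ g z) (j : Fin n) :
    dzbar j (fun w => f w + g w) z = dzbar j f z + dzbar j g z := by
  simp only [dzbar, fderiv_fun_add hf hg, add_apply]; ring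

theorem dz_sum {n : ℕ} {ι : Type*} {s : Finset ι} {f : ι → (Fin n → ℂ) → ℂ} {z : Fin n → ℂ}
    (hf : ∀ i ∈ s, DifferentiableAt ℝ (f i) z) (j : Fin n) :
    dz j (fun w => ∑ i ∈ s, f i w) z = ∑ i ∈ s, dz j (f i) z := by
  simp only [dz, fderiv_fun_sum hf, sum_apply, Finset.mul_sum, ← Finset.sum_sub_distrib]

theorem dz_mul {n : ℕ} {f g : (Fin n → ℂ) → ℂ} {z : Fin n → ℂ} (hf : DifferentiableAt ℝ f z)
    (hg : DifferentiableAt ℝ g z) (j : Fin n) :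
    dz j (fun w => f w * g w) z = dz j f z * g z + f z * dz j g z := by
  simp only [dz, fderiv_fun_mul hf hg, add_apply, smul_apply, smul_eq_mul]; ring

/-- The derivative `∂/∂z̄_j` of `log |a|²` is antiholomorphic, so that `log |a|²` does not contribute
to the complex Hessian. -/
theorem dzbar_log_sq_norm {n : ℕ} {a : (Fin n → ℂ) → ℂ} {z : Fin n → ℂ}
    (ha : DifferentiableAt ℂ a z) (ha0 : a z ≠ 0) (j : Fin n) :
    dzbar j (fun w => (Real.log (‖a w‖ ^ 2) : ℂ)) z =
      conj (fderiv ℂ a z (Pi.single j 1) / a z) := by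
  have h1 := (fderiv_real_of_complex ha).norm_sq.log (by positivity)
  have h2 := (Complex.ofRealCLM.hasFDerivAt.comp z h1).fderiv
  have h3 : fderiv ℝ (fun w => (Real.log (‖a w‖ ^ 2) : ℂ)) z = _ := h2
  have key : ∀ v, fderiv ℝ (fun w => (Real.log (‖a w‖ ^ 2) : ℂ)) z v =
      ((2 * (fderiv ℂ a z v / a z).re : ℝ) : ℂ) := by
    intro v
    rw [h3]
    simp only [ContinuousLinearMap.comp_apply, smul_apply, Complex.ofRealCLM_apply,
      ContinuousLinearMap.coe_restrictScalars', innerSL_apply_apply, smul_eq_mul]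
    congr 1
    have hn : ‖a z‖ ^ 2 = (a z).re ^ 2 + (a z).im ^ 2 := by
      rw [← Complex.normSq_eq_norm_sq, Complex.normSq_apply]; ring
    rw [Complex.div_re, Complex.normSq_eq_norm_sq, Complex.inner]
    simp
    ring
  rw [dzbar, key, key, single_I, map_smul, smul_eq_mul, mul_div_assoc]
  generalize fderiv ℂ a z (Pi.single j 1) / a z = u
  apply Complex.ext <;> simp

/-- The complex Hessian transforms as a `(1,1)`-form under holomorphic changes of coordinates, and
is not changed by the addition of the pluriharmonic function `log |a|²`. -/
theorem leviMatrix_comp_add_log {n : ℕ} {U : Set (Fin n → ℂ)} (hU : IsOpen U)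
    {φ ψ : (Fin n → ℂ) → ℝ} {T : (Fin n → ℂ) → (Fin n → ℂ)} {a : (Fin n → ℂ) → ℂ}
    (hT : ContDiffOn ℂ ω T U) (ha : ContDiffOn ℂ ω a U) (ha0 : ∀ z ∈ U, a z ≠ 0)
    (hφ : ∀ z ∈ U, ContDiffAt ℝ ∞ φ (T z))
    (hψ : ∀ z ∈ U, ψ z = φ (T z) + Real.log (‖a z‖ ^ 2)) {z : Fin n → ℂ} (hz : z ∈ U) :
    leviMatrix ψ z =
      (LinearMap.toMatrix' (fderiv ℂ T z : (Fin n → ℂ) →ₗ[ℂ] (Fin n → ℂ))).transpose *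
      leviMatrix φ (T z) *
      (LinearMap.toMatrix' (fderiv ℂ T z : (Fin n → ℂ) →ₗ[ℂ] (Fin n → ℂ))).map conj := by
  have hTd : ∀ w ∈ U, DifferentiableAt ℂ T w := fun w hw =>
    (hT.contDiffAt (hU.mem_nhds hw)).differentiableAt (by simp)
  have had : ∀ w ∈ U, DifferentiableAt ℂ a w := fun w hw =>
    (ha.contDiffAt (hU.mem_nhds hw)).differentiableAt (by simp)
  have hT' : ∀ v l, DifferentiableAt ℂ (fun w => fderiv ℂ T w v l) z := fun v l => by
    have h1 : DifferentiableAt ℂ (fderiv ℂ T) z :=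
      ((hT.contDiffAt (hU.mem_nhds hz)).fderiv_right (m := 1) (by simp)).differentiableAt (by simp)
    exact differentiableAt_pi.1 (h1.clm_apply (differentiableAt_const v)) l
  have ha' : ∀ v, DifferentiableAt ℂ (fun w => fderiv ℂ a w v / a w) z := fun v => by
    have h1 : DifferentiableAt ℂ (fderiv ℂ a) z :=
      ((ha.contDiffAt (hU.mem_nhds hz)).fderiv_right (m := 1) (by simp)).differentiableAt (by simp)
    simp only [div_eq_mul_inv]
    exact (h1.clm_apply (differentiableAt_const v)).mul ((had z hz).inv (ha0 z hz))
  have hconj : ∀ h : (Fin n → ℂ) → ℂ, DifferentiableAt ℂ h z →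
      DifferentiableAt ℝ (fun w => conj (h w)) z := fun h hh =>
    Complex.conjCLE.differentiableAt.comp z (fderiv_real_of_complex hh).differentiableAt
  have hφd : ∀ w ∈ U, DifferentiableAt ℝ (fun y => (φ y : ℂ)) (T w) := fun w hw =>
    Complex.ofRealCLM.differentiableAt.comp _ ((hφ w hw).differentiableAt (by simp))
  have hφb : ∀ l, DifferentiableAt ℝ (dzbar l fun y => (φ y : ℂ)) (T z) := fun l => by
    have h0 : ContDiffAt ℝ ∞ (fun y => (φ y : ℂ)) (T z) :=
      Complex.ofRealCLM.contDiff.contDiffAt.comp _ (hφ z hz)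
    have h1 : DifferentiableAt ℝ (fderiv ℝ fun y => (φ y : ℂ)) (T z) :=
      (h0.fderiv_right (m := 1) (by norm_cast)).differentiableAt (by simp)
    exact (((h1.clm_apply (differentiableAt_const _)).add
      ((h1.clm_apply (differentiableAt_const _)).const_mul _)).const_mul _)
  ext j k
  have hbar : (dzbar k fun w => (ψ w : ℂ)) =ᶠ[nhds z] fun w =>
      (∑ l, dzbar l (fun y => (φ y : ℂ)) (T w) * conj (fderiv ℂ T w (Pi.single k 1) l)) +
        conj (fderiv ℂ a w (Pi.single k 1) / a w) := by
    filter_upwards [hU.mem_nhds hz] with w hw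
    have e : (fun w => (ψ w : ℂ)) =ᶠ[nhds w] fun w =>
        (φ (T w) : ℂ) + (Real.log (‖a w‖ ^ 2) : ℂ) := by
      filter_upwards [hU.mem_nhds hw] with y hy
      rw [hψ y hy]; push_cast; rfl
    have h1 : DifferentiableAt ℝ (fun w => (φ (T w) : ℂ)) w :=
      (hφd w hw).comp w (fderiv_real_of_complex (hTd w hw)).differentiableAt
    have h2 : DifferentiableAt ℝ (fun w => (Real.log (‖a w‖ ^ 2) : ℂ)) w :=
      Complex.ofRealCLM.differentiableAt.comp w
        ((fderiv_real_of_complex (had w hw)).norm_sq.log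
          (by have := ha0 w hw; positivity)).differentiableAt
    rw [dzbar, e.fderiv_eq, ← dzbar, dzbar_add h1 h2,
      dzbar_comp_holomorphic (f := fun y => (φ y : ℂ)) (hφd w hw) (hTd w hw),
      dzbar_log_sq_norm (had w hw) (ha0 w hw)]
  have hTr := (fderiv_real_of_complex (hTd z hz)).differentiableAt
  have hc : ∀ l, DifferentiableAt ℝ (fun w => dzbar l (fun y => (φ y : ℂ)) (T w)) z := fun l =>
    (hφb l).comp z hTr
  have hp : ∀ l, DifferentiableAt ℝ (fun w => dzbar l (fun y => (φ y : ℂ)) (T w) *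
      conj (fderiv ℂ T w (Pi.single k 1) l)) z := fun l => (hc l).mul (hconj _ (hT' _ l))
  rw [leviMatrix, Matrix.of_apply, dz, hbar.fderiv_eq, ← dz,
    dz_add (DifferentiableAt.fun_sum fun l _ => hp l) (hconj _ (ha' _)),
    dz_conj_holomorphic (ha' _), add_zero, dz_sum fun l _ => hp l]
  simp only [Matrix.mul_apply, Matrix.transpose_apply, Matrix.map_apply, LinearMap.toMatrix'_apply,
    leviMatrix, Matrix.of_apply, Finset.sum_mul]
  refine Finset.sum_congr rfl fun l _ => ?_
  rw [dz_mul (hc l) (hconj _ (hT' _ l)), dz_conj_holomorphic (hT' _ l), mul_zero, add_zero,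
    dz_comp_holomorphic (hφb l) (hTd z hz), Finset.sum_mul]
  refine Finset.sum_congr rfl fun i _ => ?_
  simp only [ContinuousLinearMap.coe_coe]
  ring

/-- The sum over `τ` alone is the determinant of `H` for each fixed `σ`, whence the factor `n!`. -/
theorem topPowerDensity_eq {n : ℕ} (H : Matrix (Fin n) (Fin n) ℂ) :
    topPowerDensity H = n.factorial * H.det.re / Real.pi ^ n := by
  have h : ∀ σ : Equiv.Perm (Fin n), ∑ τ : Equiv.Perm (Fin n),
      ((Equiv.Perm.sign σ : ℤ) : ℂ) * ((Equiv.Perm.sign τ : ℤ) : ℂ) * ∏ a, H (σ a) (τ a) =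
      H.det := by
    intro σ
    have h1 := Matrix.det_permute σ H
    rw [← Matrix.det_transpose (H.submatrix _ _), Matrix.det_apply'] at h1
    simp only [Matrix.transpose_apply, Matrix.submatrix_apply, id] at h1
    simp only [mul_assoc]
    rw [← Finset.mul_sum, h1, ← mul_assoc]
    rw [← Int.cast_mul, ← Units.val_mul, ← sq, Int.units_sq]; simp
  simp only [topPowerDensity, h, Finset.sum_const, Finset.card_univ, Fintype.card_perm,
    Fintype.card_fin, nsmul_eq_mul]
  rw [← Complex.ofReal_natCast, Complex.re_ofReal_mul]

/-! ### Coordinate changes -/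

section Transition

variable {n : ℕ} {X : Type*} [TopologicalSpace X] [ChartedSpace (Fin n → ℂ) X]

/-- The coordinate change from the preferred chart at `p` to the preferred chart at `q`. -/
def transition (p q : X) (z : Fin n → ℂ) : Fin n → ℂ := chartAt (Fin n → ℂ) q (pt p z)

theorem isOpen_coordSet (p : X) {S : Set X} (hS : IsOpen S) : IsOpen (coordSet (n := n) p S) :=
  (chartAt (Fin n → ℂ) p).isOpen_inter_preimage_symm hS

theorem coordSet_mono (p : X) {S S' : Set X} (h : S ⊆ S') :
    coordSet (n := n) p S ⊆ coordSet p S' := fun _ hz => ⟨hz.1, h hz.2⟩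

theorem pt_transition {p q : X} {z : Fin n → ℂ} (h : pt p z ∈ (chartAt (Fin n → ℂ) q).source) :
    pt q (transition p q z) = pt p z := (chartAt (Fin n → ℂ) q).left_inv h

theorem transition_mem {p q : X} {S : Set X} {z : Fin n → ℂ} (hz : z ∈ coordSet p S)
    (hS : S ⊆ (chartAt (Fin n → ℂ) q).source) : transition p q z ∈ coordSet q S := by
  have h : pt p z ∈ S := hz.2
  refine ⟨(chartAt (Fin n → ℂ) q).map_source (hS h), ?_⟩
  change pt q (transition p q z) ∈ S
  rwa [pt_transition (hS h)]

theorem transition_transition {p q : X} {S : Set X} {z : Fin n → ℂ} (hz : z ∈ coordSet p S)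
    (hS : S ⊆ (chartAt (Fin n → ℂ) q).source) : transition q p (transition p q z) = z := by
  have h : pt p z ∈ S := hz.2
  rw [transition, pt_transition (hS h)]
  exact (chartAt (Fin n → ℂ) p).right_inv hz.1

theorem injOn_transition {p q : X} {S : Set X} (hS : S ⊆ (chartAt (Fin n → ℂ) q).source) :
    Set.InjOn (transition (n := n) p q) (coordSet p S) := fun a ha b hb hab => by
  rw [← transition_transition ha hS, hab, transition_transition hb hS]

theorem image_transition {p q : X} {S : Set X} (hp : S ⊆ (chartAt (Fin n → ℂ) p).source)
    (hq : S ⊆ (chartAt (Fin n → ℂ) q).source) :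
    transition (n := n) p q '' coordSet p S = coordSet q S := by
  apply Set.Subset.antisymm
  · rintro _ ⟨z, hz, rfl⟩
    exact transition_mem hz hq
  · intro w hw
    exact ⟨transition q p w, transition_mem hw hp, transition_transition hw hp⟩

variable [IsManifold 𝓘(ℂ, Fin n → ℂ) ω X]

theorem contMDiffOn_pt (p : X) : ContMDiffOn 𝓘(ℂ, Fin n → ℂ) 𝓘(ℂ, Fin n → ℂ) ω
    (pt (X := X) (n := n) p) (chartAt (Fin n → ℂ) p).target := contMDiffOn_chart_symm

theorem contDiffOn_transition (p q : X) : ContDiffOn ℂ ω (transition (n := n) p q)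
    (coordSet p (chartAt (Fin n → ℂ) q).source) := by
  rw [← contMDiffOn_iff_contDiffOn]
  exact (contMDiffOn_chart (I := 𝓘(ℂ, Fin n → ℂ)) (x := q) (n := ω)).comp
    ((contMDiffOn_pt p).mono fun z hz => hz.1) fun z hz => hz.2

/-- The coordinate vector fields at `p` in terms of those at `q`, by the chain rule. -/
theorem coordVec_transition {p q : X} {z : Fin n → ℂ}
    (hz : z ∈ coordSet p (chartAt (Fin n → ℂ) q).source) (j : Fin n) :
    (coordVec p z j : Fin n → ℂ) =
      (mfderiv 𝓘(ℂ, Fin n → ℂ) 𝓘(ℂ, Fin n → ℂ) (pt (X := X) q) (transition p q z) :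
        (Fin n → ℂ) →L[ℂ] (Fin n → ℂ)) (fderiv ℂ (transition p q) z (Pi.single j 1)) := by
  have hU := isOpen_coordSet (n := n) p (chartAt (Fin n → ℂ) q).open_source
  have hev : pt (X := X) (n := n) p =ᶠ[nhds z] pt q ∘ transition p q := by
    filter_upwards [hU.mem_nhds hz] with w hw
    exact (pt_transition hw.2).symm
  have h1 : MDifferentiableAt 𝓘(ℂ, Fin n → ℂ) 𝓘(ℂ, Fin n → ℂ) (pt (X := X) q)
      (transition p q z) :=
    ((contMDiffOn_pt q).contMDiffAt ((chartAt (Fin n → ℂ) q).open_target.mem_nhds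
      ((chartAt (Fin n → ℂ) q).map_source hz.2))).mdifferentiableAt (by simp)
  have h2 : DifferentiableAt ℂ (transition p q) z :=
    ((contDiffOn_transition p q).contDiffAt (hU.mem_nhds hz)).differentiableAt (by simp)
  have h3 := (h1.hasMFDerivAt.comp z h2.hasFDerivAt.hasMFDerivAt).congr_of_eventuallyEq hev
  rw [coordVec, h3.mfderiv]
  rfl

end Transition

/-! ### Frame changes and the curvature form -/

section Frames

variable {n : ℕ} {X : Type*} [TopologicalSpace X] [ChartedSpace (Fin n → ℂ) X]
  (L : X → Type*) [TopologicalSpace (Bundle.TotalSpace ℂ L)] [∀ x, TopologicalSpace (L x)]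
  [∀ x, AddCommGroup (L x)] [∀ x, Module ℂ (L x)] [FiberBundle ℂ L] [VectorBundle ℂ ℂ L]

set_option linter.unusedSectionVars false in
theorem isOpen_frameNhd (p : X) : IsOpen (frameNhd (n := n) L p) :=
  (chartAt (Fin n → ℂ) p).open_source.inter (trivializationAt ℂ L p).open_baseSet

/-- The factor `a` with `e_q = a e_p` for the preferred frames at `p` and `q`. -/
def frameChange (p q x : X) : ℂ := (trivializationAt ℂ L p).linearMapAt ℂ x (frame L q x)

variable {L}

theorem linearMapAt_frame {p x : X} (hx : x ∈ (trivializationAt ℂ L p).baseSet) :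
    (trivializationAt ℂ L p).linearMapAt ℂ x (frame L p x) = 1 :=
  (trivializationAt ℂ L p).linearMapAt_symm hx 1

theorem eq_linearMapAt_smul_frame {p x : X} (hx : x ∈ (trivializationAt ℂ L p).baseSet) (v : L x) :
    v = (trivializationAt ℂ L p).linearMapAt ℂ x v • frame L p x := by
  conv_lhs => rw [← (trivializationAt ℂ L p).symmₗ_linearMapAt (R := ℂ) hx v]
  conv_lhs => rw [← mul_one ((trivializationAt ℂ L p).linearMapAt ℂ x v), ← smul_eq_mul, map_smul,
    Bundle.Trivialization.coe_symmₗ _ hx]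
  rfl

theorem linearMapAt_eq_frameChange_mul {p q x : X} (hq : x ∈ (trivializationAt ℂ L q).baseSet)
    (v : L x) : (trivializationAt ℂ L p).linearMapAt ℂ x v =
      frameChange L p q x * (trivializationAt ℂ L q).linearMapAt ℂ x v := by
  conv_lhs => rw [eq_linearMapAt_smul_frame hq v, map_smul]
  rw [smul_eq_mul, mul_comm]
  rfl

theorem frameChange_ne_zero {p q x : X} (hp : x ∈ (trivializationAt ℂ L p).baseSet)
    (hq : x ∈ (trivializationAt ℂ L q).baseSet) : frameChange L p q x ≠ 0 := by
  intro h
  have h1 := linearMapAt_eq_frameChange_mul (p := p) hq (frame L p x)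
  rw [linearMapAt_frame hp, h, zero_mul] at h1
  exact one_ne_zero h1

theorem contDiffOn_frameChange [IsManifold 𝓘(ℂ, Fin n → ℂ) ω X]
    [ContMDiffVectorBundle ω ℂ L 𝓘(ℂ, Fin n → ℂ)] (p q : X) :
    ContDiffOn ℂ ω (fun z : Fin n → ℂ => frameChange L p q (pt p z))
      (coordSet p (frameNhd (n := n) L p ∩ frameNhd (n := n) L q)) := by
  rw [← contMDiffOn_iff_contDiffOn]
  have h := (contMDiffOn_coordChangeL (IB := 𝓘(ℂ, Fin n → ℂ)) (n := ω) (trivializationAt ℂ L q)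
    (trivializationAt ℂ L p)).clm_apply (contMDiffOn_const (c := (1 : ℂ)))
  have h2 := h.comp (((contMDiffOn_pt p).mono fun z hz => hz.1 :
    ContMDiffOn 𝓘(ℂ, Fin n → ℂ) 𝓘(ℂ, Fin n → ℂ) ω (pt (X := X) (n := n) p)
      (coordSet p (frameNhd (n := n) L p ∩ frameNhd (n := n) L q))))
    fun z hz => ⟨hz.2.2.2, hz.2.1.2⟩
  refine h2.congr fun z hz => ?_
  have h3 := Bundle.Trivialization.coordChangeL_apply (R := ℂ) (trivializationAt ℂ L q)
    (trivializationAt ℂ L p) (b := pt p z) ⟨hz.2.2.2, hz.2.1.2⟩ 1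
  refine Eq.trans ?_ h3.symm
  exact congrFun (Bundle.Trivialization.coe_linearMapAt_of_mem (R := ℂ) (trivializationAt ℂ L p)
    (b := pt p z) hz.2.1.2) _

variable (h : HermitianMetric (n := n) L)

theorem HermitianMetric.frameNormSq_pos {p : X} {z : Fin n → ℂ}
    (hz : pt p z ∈ (trivializationAt ℂ L p).baseSet) : 0 < h.frameNormSq p z := by
  refine h.pos _ _ fun h0 => ?_
  have := linearMapAt_frame hz
  rw [h0, map_zero] at this
  exact zero_ne_one this

theorem HermitianMetric.frameNormSq_eq_exp {p : X} {z : Fin n → ℂ}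
    (hz : pt p z ∈ (trivializationAt ℂ L p).baseSet) :
    h.frameNormSq p z = Real.exp (-h.weight p z) := by
  rw [HermitianMetric.weight, neg_neg, Real.exp_log (h.frameNormSq_pos hz)]

theorem HermitianMetric.contDiffOn_weight (p : X) :
    ContDiffOn ℝ ∞ (h.weight p) (coordSet p (frameNhd (n := n) L p)) :=
  ((h.smooth p).log fun _ hz => (h.frameNormSq_pos hz.2.2).ne').neg

theorem HermitianMetric.frameNormSq_transition {p q : X} {z : Fin n → ℂ}
    (hp : pt p z ∈ (trivializationAt ℂ L p).baseSet)
    (hq : pt p z ∈ (chartAt (Fin n → ℂ) q).source) :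
    h.frameNormSq q (transition p q z) =
      ‖frameChange L p q (pt p z)‖ ^ 2 * h.frameNormSq p z := by
  unfold HermitianMetric.frameNormSq
  rw [pt_transition hq]
  have h1 := eq_linearMapAt_smul_frame hp (frame L q (pt p z))
  conv_lhs => rw [h1]
  simp only [map_smulₛₗ, LinearMap.smul_apply, smul_eq_mul, RingHom.id_apply]
  rw [← frameChange, ← mul_assoc, mul_comm (conj _), Complex.mul_conj, Complex.normSq_eq_norm_sq,
    Complex.re_ofReal_mul]

/-- The curvature matrices are the coefficients of a globally defined `(1,1)`-form. -/
theorem HermitianMetric.curvature_transition [IsManifold 𝓘(ℂ, Fin n → ℂ) ω X]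
    [ContMDiffVectorBundle ω ℂ L 𝓘(ℂ, Fin n → ℂ)] {p q : X} {z : Fin n → ℂ}
    (hz : z ∈ coordSet p (frameNhd (n := n) L p ∩ frameNhd (n := n) L q)) :
    h.curvature p z =
      (LinearMap.toMatrix' (fderiv ℂ (transition p q) z : (Fin n → ℂ) →ₗ[ℂ] (Fin n → ℂ))).transpose *
      h.curvature q (transition p q z) *
      (LinearMap.toMatrix' (fderiv ℂ (transition p q) z :
        (Fin n → ℂ) →ₗ[ℂ] (Fin n → ℂ))).map conj := by
  have hU : IsOpen (coordSet (n := n) p (frameNhd (n := n) L p ∩ frameNhd (n := n) L q)) :=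
    isOpen_coordSet p ((isOpen_frameNhd L p).inter (isOpen_frameNhd L q))
  refine leviMatrix_comp_add_log hU
    ((contDiffOn_transition p q).mono (coordSet_mono p fun x hx => hx.2.1))
    (contDiffOn_frameChange p q) (fun w hw => frameChange_ne_zero hw.2.1.2 hw.2.2.2)
    (fun w hw => ?_) (fun w hw => ?_) hz
  · exact (h.contDiffOn_weight q).contDiffAt ((isOpen_coordSet q (isOpen_frameNhd L q)).mem_nhds
      (transition_mem (coordSet_mono p Set.inter_subset_right hw) fun x hx => hx.1))
  · have h0 := h.frameNormSq_pos hw.2.1.2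
    have ha := frameChange_ne_zero hw.2.1.2 hw.2.2.2
    rw [HermitianMetric.weight, HermitianMetric.weight,
      h.frameNormSq_transition hw.2.1.2 hw.2.2.1, Real.log_mul (by positivity) h0.ne']
    ring

end Frames

/-! ### Transformation of the coefficients of sections -/

section Coefficients

variable {n : ℕ} {X : Type*} [TopologicalSpace X] [ChartedSpace (Fin n → ℂ) X]
  {L : X → Type*} [TopologicalSpace (Bundle.TotalSpace ℂ L)] [∀ x, TopologicalSpace (L x)]
  [∀ x, AddCommGroup (L x)] [∀ x, Module ℂ (L x)] [FiberBundle ℂ L] [VectorBundle ℂ ℂ L]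
  {A : X → Type*} [TopologicalSpace (Bundle.TotalSpace ℂ A)] [∀ x, TopologicalSpace (A x)]
  [∀ x, AddCommGroup (A x)] [∀ x, Module ℂ (A x)] [FiberBundle ℂ A] [VectorBundle ℂ ℂ A]
  {k m : ℕ}

theorem powCoeff_eq {p q x : X} (hq : x ∈ (trivializationAt ℂ L q).baseSet) :
    powCoeff L k p x = frameChange L p q x ^ k • powCoeff L k q x := by
  refine PiTensorProduct.ext (MultilinearMap.ext fun v => ?_)
  simp [powCoeff, linearMapAt_eq_frameChange_mul (p := p) hq, Finset.prod_mul_distrib]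

/-- The coordinate of an element of the fibre of `L^k ⊗ A^m ⊗ K_X` at `x` with respect to the
preferred frames at `p`, the form being evaluated at the tangent vectors `v`. It agrees with `coeff`
by definition, but the base point is a variable of its own, so that it can be rewritten. -/
def coeffAt (L : X → Type*) [TopologicalSpace (Bundle.TotalSpace ℂ L)]
    [∀ x, TopologicalSpace (L x)] [∀ x, AddCommGroup (L x)] [∀ x, Module ℂ (L x)] [FiberBundle ℂ L]
    [VectorBundle ℂ ℂ L] (A : X → Type*) [TopologicalSpace (Bundle.TotalSpace ℂ A)]
    [∀ x, TopologicalSpace (A x)] [∀ x, AddCommGroup (A x)] [∀ x, Module ℂ (A x)]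
    [FiberBundle ℂ A] [VectorBundle ℂ ℂ A] (k m : ℕ) (p x : X) (v : Fin n → Fin n → ℂ) :
    AdjFibre (n := n) L A k m x →ₗ[ℂ] ℂ :=
  LinearMap.mul' ℂ ℂ ∘ₗ TensorProduct.map
    (LinearMap.mul' ℂ ℂ ∘ₗ TensorProduct.map (powCoeff L k p x) (powCoeff A m p x))
    { toFun := fun α => α (fun j => (v j : TangentSpace 𝓘(ℂ, Fin n → ℂ) x))
      map_add' := fun _ _ => rfl
      map_smul' := fun _ _ => rfl }

theorem alternatingMap_comp_apply {n : ℕ} (β : (Fin n → ℂ) [⋀^Fin n]→ₗ[ℂ] ℂ)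
    (D T : (Fin n → ℂ) →L[ℂ] (Fin n → ℂ)) :
    β (fun j => D (T (Pi.single j 1))) = T.det * β (fun j => D (Pi.single j 1)) := by
  set γ := β.compLinearMap (D : (Fin n → ℂ) →ₗ[ℂ] (Fin n → ℂ))
  have e1 : β (fun j => D (T (Pi.single j 1))) =
      γ ((T : (Fin n → ℂ) →ₗ[ℂ] (Fin n → ℂ)) ∘ Pi.basisFun ℂ (Fin n)) := by
    simp only [γ, AlternatingMap.compLinearMap_apply]
    congr 1; ext j : 1
    simp
  have e2 : β (fun j => D (Pi.single j 1)) = γ (Pi.basisFun ℂ (Fin n)) := by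
    simp only [γ, AlternatingMap.compLinearMap_apply]
    congr 1; ext j : 1
    simp
  rw [e1, e2, AlternatingMap.eq_smul_basis_det (Pi.basisFun ℂ (Fin n)) γ]
  simp only [AlternatingMap.smul_apply, Module.Basis.det_comp, Module.Basis.det_self,
    smul_eq_mul, mul_one]
  rw [mul_comm]

/-- The coefficient changes by the `k`-th and `m`-th powers of the frame changes and by the
determinant of the change of tangent vectors. -/
theorem coeffAt_eq {p q x : X} (hL : x ∈ (trivializationAt ℂ L q).baseSet)
    (hA : x ∈ (trivializationAt ℂ A q).baseSet) {v v' : Fin n → Fin n → ℂ}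
    (D T : (Fin n → ℂ) →L[ℂ] (Fin n → ℂ)) (hv : ∀ j, v j = D (T (Pi.single j 1)))
    (hv' : ∀ j, v' j = D (Pi.single j 1)) (ξ : AdjFibre (n := n) L A k m x) :
    coeffAt L A k m p x v ξ =
      frameChange L p q x ^ k * frameChange A p q x ^ m * T.det * coeffAt L A k m q x v' ξ := by
  obtain rfl : v = fun j => D (T (Pi.single j 1)) := funext hv
  obtain rfl : v' = fun j => D (Pi.single j 1) := funext hv'
  have key : coeffAt (n := n) L A k m p x (fun j => D (T (Pi.single j 1))) =
      (frameChange L p q x ^ k * frameChange A p q x ^ m * T.det) •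
        coeffAt (n := n) L A k m q x (fun j => D (Pi.single j 1)) := by
    refine TensorProduct.ext' fun t α => ?_
    induction t using TensorProduct.induction_on with
    | zero => simp
    | add a b ha hb => rw [TensorProduct.add_tmul, map_add, map_add, ha, hb]
    | tmul a b =>
      have hα : α (fun j => (D (T (Pi.single j 1)) : TangentSpace 𝓘(ℂ, Fin n → ℂ) x)) =
          T.det * α (fun j => (D (Pi.single j 1) : TangentSpace 𝓘(ℂ, Fin n → ℂ) x)) :=
        alternatingMap_comp_apply (n := n) α D T
      simp only [coeffAt, powCoeff_eq (p := p) hL, powCoeff_eq (p := p) hA, LinearMap.comp_apply,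
        TensorProduct.map_tmul, LinearMap.mul'_apply, LinearMap.smul_apply, smul_eq_mul,
        LinearMap.coe_mk, AddHom.coe_mk, hα]
      ring
  rw [key, LinearMap.smul_apply, smul_eq_mul]

variable [IsManifold 𝓘(ℂ, Fin n → ℂ) ω X]

theorem coeff_transition {p q : X} {z : Fin n → ℂ}
    (hz : z ∈ coordSet p (adjNhd (n := n) L A q)) (s : ∀ x, AdjFibre (n := n) L A k m x) :
    coeff L A k m p z (s (pt p z)) =
      frameChange L p q (pt p z) ^ k * frameChange A p q (pt p z) ^ m *
        (fderiv ℂ (transition p q) z).det *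
        coeff L A k m q (transition p q z) (s (pt q (transition p q z))) := by
  have hx := pt_transition (p := p) (q := q) (z := z) hz.2.1.1
  -- `pt q (transition p q z)` and `pt p z` are equal but not by definition, so the section has to be
  -- transported along this equality.
  have hswap : ∀ (y : X) (v : Fin n → Fin n → ℂ), y = pt p z →
      coeffAt L A k m q y v (s y) = coeffAt L A k m q (pt p z) v (s (pt p z)) := by
    rintro y v rfl; rfl
  refine Eq.trans ?_ (congrArg (fun t : ℂ => frameChange L p q (pt p z) ^ k *
    frameChange A p q (pt p z) ^ m * (fderiv ℂ (transition p q) z).det * t)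
    (hswap _ (coordVec q (transition p q z)) hx).symm)
  exact coeffAt_eq hz.2.1.2 hz.2.2.2
    (mfderiv 𝓘(ℂ, Fin n → ℂ) 𝓘(ℂ, Fin n → ℂ) (pt (X := X) q) (transition p q z))
    (fderiv ℂ (transition p q) z) (fun j => coordVec_transition
      (coordSet_mono p (fun x hx => hx.1.1) hz) j) (fun j => rfl) (s (pt p z))

/-- The densities `⟨s, t⟩` are those of a globally defined `(n,n)`-form: the frame changes in the
coefficients cancel against those in the metrics. -/
theorem pairing_transition (hL : HermitianMetric (n := n) L) (hA : HermitianMetric (n := n) A)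
    {p q : X} {z : Fin n → ℂ}
    (hz : z ∈ coordSet p (adjNhd (n := n) L A p ∩ adjNhd (n := n) L A q))
    (s t : ∀ x, AdjFibre (n := n) L A k m x) :
    pairing k m hL hA s t p z = ((‖(fderiv ℂ (transition p q) z).det‖ ^ 2 : ℝ) : ℂ) *
      pairing k m hL hA s t q (transition p q z) := by
  have hz' : z ∈ coordSet p (adjNhd (n := n) L A q) := coordSet_mono p Set.inter_subset_right hz
  have e : ∀ a : ℂ, a * conj a = ((‖a‖ ^ 2 : ℝ) : ℂ) := fun a => by
    rw [Complex.mul_conj, Complex.normSq_eq_norm_sq]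
  unfold pairing
  rw [coeff_transition hz' s, coeff_transition hz' t,
    hL.frameNormSq_transition hz.2.1.1.2 hz.2.2.1.1, hA.frameNormSq_transition hz.2.1.2.2 hz.2.2.1.1]
  push_cast
  have e' : ∀ a : ℂ, a * conj a = (‖a‖ : ℂ) ^ 2 := fun a => by rw [e]; push_cast; rfl
  simp only [map_mul, map_pow, mul_pow]
  rw [← e', ← e', ← e']
  simp only [mul_pow]
  ring

end Coefficients

/-! ### Integration of densities -/

section Mass

open MeasureTheory

variable {n : ℕ} {X : Type*} [TopologicalSpace X] [ChartedSpace (Fin n → ℂ) X]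

theorem measurableSet_coordSet (p : X) {S : Set X} (hS : MeasurableSet[borel X] S) :
    MeasurableSet (coordSet (n := n) p S) := by
  induction S, hS using MeasurableSpace.generateFrom_induction with
  | hC S hS _ => exact (isOpen_coordSet p hS).measurableSet
  | empty => simp [coordSet]
  | compl S _ ih =>
    have : coordSet (n := n) p Sᶜ = (chartAt (Fin n → ℂ) p).target \ coordSet p S := by
      ext z; simp only [coordSet, Set.mem_inter_iff, Set.mem_preimage, Set.mem_sdiff,
        Set.mem_compl_iff]; tauto
    rw [this]
    exact (chartAt (Fin n → ℂ) p).open_target.measurableSet.diff ih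
  | iUnion S _ ih =>
    have : coordSet (n := n) p (⋃ i, S i) = ⋃ i, coordSet p (S i) := by
      simp only [coordSet, Set.preimage_iUnion, Set.inter_iUnion]
    rw [this]
    exact MeasurableSet.iUnion ih

theorem lintegral_coordSet_le_sum {ι : Type*} [Fintype ι] {p : X} {S : Set X} {S' : ι → Set X}
    (h : S ⊆ ⋃ i, S' i) (f : (Fin n → ℂ) → ENNReal) :
    ∫⁻ z in coordSet p S, f z ≤ ∑ i, ∫⁻ z in coordSet p (S ∩ S' i), f z := by
  have hsub : coordSet (n := n) p S ⊆ ⋃ i, coordSet p (S ∩ S' i) := by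
    intro z hz
    obtain ⟨i, hi⟩ := Set.mem_iUnion.1 (h hz.2)
    exact Set.mem_iUnion.2 ⟨i, hz.1, hz.2, hi⟩
  refine (lintegral_mono_set hsub).trans ((lintegral_iUnion_le _ _).trans ?_)
  rw [tsum_fintype]

variable (L : X → Type*) [TopologicalSpace (Bundle.TotalSpace ℂ L)] [∀ x, TopologicalSpace (L x)]
  [∀ x, AddCommGroup (L x)] [∀ x, Module ℂ (L x)] [FiberBundle ℂ L] [VectorBundle ℂ ℂ L]
  (A : X → Type*) [TopologicalSpace (Bundle.TotalSpace ℂ A)] [∀ x, TopologicalSpace (A x)]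
  [∀ x, AddCommGroup (A x)] [∀ x, Module ℂ (A x)] [FiberBundle ℂ A] [VectorBundle ℂ ℂ A]

theorem isOpen_adjNhd (p : X) : IsOpen (adjNhd (n := n) L A p) :=
  (isOpen_frameNhd L p).inter (isOpen_frameNhd A p)

set_option linter.unusedSectionVars false in
theorem mem_adjNhd (p : X) : p ∈ adjNhd (n := n) L A p :=
  ⟨⟨mem_chart_source _ p, FiberBundle.mem_baseSet_trivializationAt' p⟩,
    ⟨mem_chart_source _ p, FiberBundle.mem_baseSet_trivializationAt' p⟩⟩

set_option linter.unusedSectionVars false in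
theorem adjNhd_subset_source (p : X) : adjNhd (n := n) L A p ⊆ (chartAt (Fin n → ℂ) p).source :=
  fun _ h => h.1.1

/-- The functions `η p` on the coordinate spaces are the densities of an `(n,n)`-form on `X`. -/
def IsDensity (η : X → (Fin n → ℂ) → ℝ) : Prop :=
  ∀ p q z, z ∈ coordSet p (adjNhd (n := n) L A p ∩ adjNhd (n := n) L A q) →
    η p z = ‖(fderiv ℂ (transition p q) z).det‖ ^ 2 * η q (transition p q z)

variable {L A}

/-- The integral of a density does not depend on the coordinates, by the change of variables
formula. -/
theorem IsDensity.lintegral_eq [IsManifold 𝓘(ℂ, Fin n → ℂ) ω X] {η : X → (Fin n → ℂ) → ℝ}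
    (hη : IsDensity L A η) {p q : X} {S : Set X} (hS : MeasurableSet[borel X] S)
    (hp : S ⊆ adjNhd (n := n) L A p) (hq : S ⊆ adjNhd (n := n) L A q) :
    ∫⁻ z in coordSet p S, ENNReal.ofReal (η p z) =
      ∫⁻ z in coordSet q S, ENNReal.ofReal (η q z) := by
  have hps := hp.trans (adjNhd_subset_source L A p)
  have hqs := hq.trans (adjNhd_subset_source L A q)
  rw [← image_transition hps hqs]
  have hU := isOpen_coordSet (n := n) p (chartAt (Fin n → ℂ) q).open_source
  have hder : ∀ z ∈ coordSet p S, HasFDerivWithinAt (transition p q)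
      ((fderiv ℂ (transition p q) z).restrictScalars ℝ) (coordSet p S) z := fun z hz =>
    (fderiv_real_of_complex (((contDiffOn_transition p q).contDiffAt
      (hU.mem_nhds (coordSet_mono p hqs hz))).differentiableAt (by simp))).hasFDerivWithinAt
  rw [lintegral_image_eq_lintegral_abs_det_fderiv_mul volume (measurableSet_coordSet p hS) hder
    (injOn_transition hqs)]
  refine setLIntegral_congr_fun (measurableSet_coordSet p hS) fun z hz => ?_
  rw [det_restrictScalars_eq_norm_sq, abs_of_nonneg (sq_nonneg _),
    ← ENNReal.ofReal_mul (sq_nonneg _), hη p q z ⟨hz.1, hp hz.2, hq hz.2⟩]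

section Compact

variable [CompactSpace X]

variable (L A)

theorem exists_mem_coverPiece (x : X) : ∃ i, x ∈ coverPiece (n := n) L A i := by
  have h := (exists_cover (n := n) L A).choose_spec.choose_spec x
  let s : Set (Fin (coverCard (n := n) L A)) := {i | x ∈ adjNhd (n := n) L A (coverPt L A i)}
  have hs : s.Nonempty := h
  obtain ⟨i, hi, hmin⟩ := WellFounded.has_min wellFounded_lt s hs
  refine ⟨i, hi, fun hx => ?_⟩
  obtain ⟨⟨j, hj⟩, hxj⟩ := Set.mem_iUnion.1 hx
  exact hmin j hxj hj

theorem coverPiece_subset (i : Fin (coverCard (n := n) L A)) :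
    coverPiece (n := n) L A i ⊆ adjNhd (n := n) L A (coverPt L A i) := Set.sdiff_subset

theorem measurableSet_coverPiece (i : Fin (coverCard (n := n) L A)) :
    MeasurableSet[borel X] (coverPiece (n := n) L A i) := by
  let _ : MeasurableSpace X := borel X
  have _ : BorelSpace X := ⟨rfl⟩
  exact (isOpen_adjNhd L A _).measurableSet.diff
    (isOpen_iUnion fun j => isOpen_adjNhd L A _).measurableSet

/-- The integral over `X`, possibly infinite, of the positive part of a real `(n,n)`-form. -/
def mass (η : X → (Fin n → ℂ) → ℝ) : ENNReal :=
  ∑ i, ∫⁻ z in coordSet (coverPt (n := n) L A i) (coverPiece (n := n) L A i),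
    ENNReal.ofReal (η (coverPt (n := n) L A i) z)

variable {L A}

variable [IsManifold 𝓘(ℂ, Fin n → ℂ) ω X]

theorem IsDensity.lintegral_le_mass {η : X → (Fin n → ℂ) → ℝ}
    (hη : IsDensity L A η) {q : X} {S : Set X} (hS : MeasurableSet[borel X] S)
    (hq : S ⊆ adjNhd (n := n) L A q) :
    ∫⁻ z in coordSet q S, ENNReal.ofReal (η q z) ≤ mass L A η := by
  refine (lintegral_coordSet_le_sum (S' := coverPiece (n := n) L A)
    (fun x _ => Set.mem_iUnion.2 (exists_mem_coverPiece L A x)) _).trans ?_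
  refine Finset.sum_le_sum fun i _ => ?_
  rw [hη.lintegral_eq (@MeasurableSet.inter _ (borel X) _ _ hS (measurableSet_coverPiece L A i))
    (Set.inter_subset_left.trans hq) (Set.inter_subset_right.trans (coverPiece_subset L A i))]
  exact lintegral_mono_set (coordSet_mono _ Set.inter_subset_right)

/-- The mass is controlled by the integrals over any finite family of coordinate sets covering `X`.
The sets may overlap each other and several pieces of the decomposition, which costs the factor
`coverCard`. -/
theorem IsDensity.mass_le {η : X → (Fin n → ℂ) → ℝ} (hη : IsDensity L A η) {ι : Type*} [Fintype ι]
    {q : ι → X} {S : ι → Set X} (hS : ∀ j, MeasurableSet[borel X] (S j))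
    (hq : ∀ j, S j ⊆ adjNhd (n := n) L A (q j)) (hcov : ∀ x, ∃ j, x ∈ S j) :
    mass L A η ≤ coverCard (n := n) L A *
      ∑ j, ∫⁻ z in coordSet (q j) (S j), ENNReal.ofReal (η (q j) z) := by
  have h : ∀ i : Fin (coverCard (n := n) L A),
      ∫⁻ z in coordSet (coverPt (n := n) L A i) (coverPiece (n := n) L A i),
        ENNReal.ofReal (η (coverPt (n := n) L A i) z) ≤
      ∑ j, ∫⁻ z in coordSet (q j) (S j), ENNReal.ofReal (η (q j) z) := by
    intro i
    refine (lintegral_coordSet_le_sum (S' := S)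
      (fun x _ => Set.mem_iUnion.2 (hcov x)) _).trans (Finset.sum_le_sum fun j _ => ?_)
    rw [hη.lintegral_eq
      (@MeasurableSet.inter _ (borel X) _ _ (measurableSet_coverPiece L A i) (hS j))
      (Set.inter_subset_left.trans (coverPiece_subset L A i)) (Set.inter_subset_right.trans (hq j))]
    exact lintegral_mono_set (coordSet_mono _ Set.inter_subset_right)
  refine (Finset.sum_le_sum fun i _ => h i).trans ?_
  simp

end Compact

theorem coordSet_image_pt {p : X} {B : Set (Fin n → ℂ)}
    (hB : B ⊆ (chartAt (Fin n → ℂ) p).target) : coordSet p (pt p '' B) = B := by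
  ext z
  constructor
  · rintro ⟨hz, w, hw, hwz⟩
    have := (chartAt (Fin n → ℂ) p).symm.injOn (hB hw) hz hwz
    rwa [← this]
  · exact fun hz => ⟨hB hz, z, hz, rfl⟩

theorem isCompact_image_pt {p : X} {B : Set (Fin n → ℂ)} (hB : IsCompact B)
    (hBt : B ⊆ (chartAt (Fin n → ℂ) p).target) : IsCompact (pt p '' B) :=
  hB.image_of_continuousOn ((chartAt (Fin n → ℂ) p).continuousOn_symm.mono hBt)

theorem image_pt_mem_nhds {p : X} {r : ℝ} (hr : 0 < r) :
    pt (n := n) p '' Metric.closedBall (chartAt (Fin n → ℂ) p p) r ∈ nhds p := by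
  have h := (chartAt (Fin n → ℂ) p).continuousAt (mem_chart_source _ p)
  filter_upwards [h (Metric.closedBall_mem_nhds _ hr),
    (chartAt (Fin n → ℂ) p).open_source.mem_nhds (mem_chart_source _ p)] with x hx hxs
  exact ⟨_, hx, (chartAt (Fin n → ℂ) p).left_inv hxs⟩

/-- A compact manifold is covered by finitely many closed coordinate balls of prescribed radii. -/
theorem exists_finite_cover_closedBall [CompactSpace X] {r : X → ℝ} (hr : ∀ p, 0 < r p) :
    ∃ t : Finset X, ∀ x, ∃ q ∈ t,
      x ∈ pt (n := n) q '' Metric.closedBall (chartAt (Fin n → ℂ) q q) (r q) := by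
  obtain ⟨t, ht⟩ := CompactSpace.elim_nhds_subcover
    (fun p : X => pt (n := n) p '' Metric.closedBall (chartAt (Fin n → ℂ) p p) (r p))
    (fun p => image_pt_mem_nhds (hr p))
  refine ⟨t, fun x => ?_⟩
  have : x ∈ (⊤ : Set X) := trivial
  rw [← ht] at this
  simpa using this

/-- A continuous density need not be bounded on the pieces of the decomposition, whose closures may
leave the coordinate neighbourhoods; the finiteness comes from a cover by compact coordinate
balls. -/
theorem IsDensity.mass_lt_top [T2Space X] [CompactSpace X] [IsManifold 𝓘(ℂ, Fin n → ℂ) ω X]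
    {η : X → (Fin n → ℂ) → ℝ} (hη : IsDensity L A η)
    (hc : ∀ p, ContinuousOn (η p) (coordSet p (adjNhd (n := n) L A p))) : mass L A η < ⊤ := by
  have hb : ∀ p : X, ∃ r > 0, Metric.closedBall (chartAt (Fin n → ℂ) p p) r ⊆
      coordSet p (adjNhd (n := n) L A p) := fun p => by
    refine Metric.nhds_basis_closedBall.mem_iff.1
      ((isOpen_coordSet p (isOpen_adjNhd L A p)).mem_nhds ⟨mem_chart_target _ p, ?_⟩)
    rw [Set.mem_preimage, (chartAt (Fin n → ℂ) p).left_inv (mem_chart_source _ p)]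
    exact mem_adjNhd L A p
  choose r hr hrs using hb
  obtain ⟨t, ht⟩ := exists_finite_cover_closedBall (n := n) hr
  let _ : MeasurableSpace X := borel X
  have _ : BorelSpace X := ⟨rfl⟩
  have hle := hη.mass_le (ι := t) (q := fun q => (q : X))
    (S := fun q => pt (q : X) '' Metric.closedBall (chartAt (Fin n → ℂ) (q : X) q) (r q))
    (fun q => (isCompact_image_pt (isCompact_closedBall _ _)
      ((hrs q).trans fun z hz => hz.1)).measurableSet)
    (fun q => by rintro _ ⟨z, hz, rfl⟩; exact (hrs q hz).2)
    (fun x => by obtain ⟨q, hq, hx⟩ := ht x; exact ⟨⟨q, hq⟩, hx⟩)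
  refine hle.trans_lt (ENNReal.mul_lt_top (by simp) (ENNReal.sum_lt_top.2 fun q _ => ?_))
  rw [coordSet_image_pt ((hrs q).trans fun z hz => hz.1)]
  exact (((hc q).mono (hrs q)).integrableOn_compact
    (isCompact_closedBall _ _)).lintegral_lt_top

end Mass

/-! ### The hermitian form on the space of sections -/

section Sections

open MeasureTheory

variable {n : ℕ} {X : Type*} [TopologicalSpace X] [ChartedSpace (Fin n → ℂ) X]
  {L : X → Type*} [TopologicalSpace (Bundle.TotalSpace ℂ L)] [∀ x, TopologicalSpace (L x)]
  [∀ x, AddCommGroup (L x)] [∀ x, Module ℂ (L x)] [FiberBundle ℂ L] [VectorBundle ℂ ℂ L]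
  {A : X → Type*} [TopologicalSpace (Bundle.TotalSpace ℂ A)] [∀ x, TopologicalSpace (A x)]
  [∀ x, AddCommGroup (A x)] [∀ x, Module ℂ (A x)] [FiberBundle ℂ A] [VectorBundle ℂ ℂ A]
  {k m : ℕ}

theorem powCoeff_tprod_frame {p x : X} (hx : x ∈ (trivializationAt ℂ L p).baseSet) :
    powCoeff L k p x (PiTensorProduct.tprod ℂ fun _ => frame L p x) = 1 := by
  simp [powCoeff, linearMapAt_frame hx]

theorem eq_powCoeff_smul {p x : X} (hx : x ∈ (trivializationAt ℂ L p).baseSet)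
    (t : ⨂[ℂ]^k (L x)) :
    t = powCoeff L k p x t • PiTensorProduct.tprod ℂ fun _ => frame L p x := by
  have h : LinearMap.id = (powCoeff L k p x).smulRight
      (PiTensorProduct.tprod ℂ fun _ => frame L p x) := by
    refine PiTensorProduct.ext (MultilinearMap.ext fun v => ?_)
    have hv : v = fun i => (trivializationAt ℂ L p).linearMapAt ℂ x (v i) • frame L p x :=
      funext fun i => eq_linearMapAt_smul_frame hx (v i)
    have h1 : PiTensorProduct.tprod ℂ v =
        (∏ i, (trivializationAt ℂ L p).linearMapAt ℂ x (v i)) •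
          PiTensorProduct.tprod ℂ fun _ => frame L p x := by
      conv_lhs => rw [hv]
      exact MultilinearMap.map_smul_univ _ _ _
    simpa [powCoeff] using h1
  exact LinearMap.congr_fun h t

/-- An `n`-form is determined by its value on the coordinate vectors, since the derivative of the
inverse chart is invertible. -/
theorem canCoeff_injective [IsManifold 𝓘(ℂ, Fin n → ℂ) ω X] {p : X} {z : Fin n → ℂ}
    (hz : z ∈ (chartAt (Fin n → ℂ) p).target) : Function.Injective (canCoeff p z) := by
  rw [← LinearMap.ker_eq_bot, LinearMap.ker_eq_bot']
  intro α hα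
  set D : (Fin n → ℂ) →L[ℂ] (Fin n → ℂ) :=
    mfderiv 𝓘(ℂ, Fin n → ℂ) 𝓘(ℂ, Fin n → ℂ) (pt (X := X) p) z with hD
  have hsurj : Function.Surjective D := by
    have h1 : MDifferentiableAt 𝓘(ℂ, Fin n → ℂ) 𝓘(ℂ, Fin n → ℂ) (pt (X := X) p) z :=
      ((contMDiffOn_pt p).contMDiffAt ((chartAt (Fin n → ℂ) p).open_target.mem_nhds
        hz)).mdifferentiableAt (by simp)
    have hs : pt p z ∈ (chartAt (Fin n → ℂ) p).source := (chartAt (Fin n → ℂ) p).map_target hz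
    have h2 : MDifferentiableAt 𝓘(ℂ, Fin n → ℂ) 𝓘(ℂ, Fin n → ℂ) (chartAt (Fin n → ℂ) p)
        (pt p z) :=
      ((contMDiffOn_chart (n := ω)).contMDiffAt
        ((chartAt (Fin n → ℂ) p).open_source.mem_nhds hs)).mdifferentiableAt (by simp)
    have h3 := h2.hasMFDerivAt.comp z h1.hasMFDerivAt
    have hev : (id : (Fin n → ℂ) → (Fin n → ℂ)) =ᶠ[nhds z]
        (chartAt (Fin n → ℂ) p) ∘ (pt (X := X) p) := by
      filter_upwards [(chartAt (Fin n → ℂ) p).open_target.mem_nhds hz] with w hw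
      exact ((chartAt (Fin n → ℂ) p).right_inv hw).symm
    set D' : (Fin n → ℂ) →L[ℂ] (Fin n → ℂ) := mfderiv 𝓘(ℂ, Fin n → ℂ) 𝓘(ℂ, Fin n → ℂ)
      (chartAt (Fin n → ℂ) p) (pt p z)
    have h4 : HasFDerivAt (id : (Fin n → ℂ) → (Fin n → ℂ)) (D'.comp D) z :=
      (h3.congr_of_eventuallyEq hev).hasFDerivAt
    have h5 := h4.unique (hasFDerivAt_id z)
    have hinj : Function.Injective D := by
      intro a b hab
      have ha := DFunLike.congr_fun h5 a
      have hb := DFunLike.congr_fun h5 b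
      simp only [ContinuousLinearMap.comp_apply, ContinuousLinearMap.id_apply] at ha hb
      rw [← ha, hab, hb]
    exact LinearMap.surjective_of_injective (f := (D : (Fin n → ℂ) →ₗ[ℂ] (Fin n → ℂ))) hinj
  have key : ∀ β : (Fin n → ℂ) [⋀^Fin n]→ₗ[ℂ] ℂ,
      β (fun j => D (Pi.single j 1)) = 0 → β = 0 := by
    intro β hβ
    have h0 : β.compLinearMap (D : (Fin n → ℂ) →ₗ[ℂ] (Fin n → ℂ)) = 0 := by
      rw [← AlternatingMap.map_basis_eq_zero_iff (Pi.basisFun ℂ (Fin n))]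
      simpa using hβ
    ext v
    choose w hw using fun j => hsurj (v j)
    have := DFunLike.congr_fun h0 w
    simpa [hw] using this
  exact key α hα

/-- On the coordinate neighbourhood the fibre of `L^k ⊗ A^m ⊗ K_X` is one-dimensional, spanned by the
tensor product of the frames. -/
theorem eq_zero_of_coeff_eq_zero [IsManifold 𝓘(ℂ, Fin n → ℂ) ω X] {p : X} {z : Fin n → ℂ}
    (hz : z ∈ coordSet p (adjNhd (n := n) L A p)) {ξ : AdjFibre (n := n) L A k m (pt p z)}
    (hξ : coeff L A k m p z ξ = 0) : ξ = 0 := by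
  have hzL : pt p z ∈ (trivializationAt ℂ L p).baseSet := hz.2.1.2
  have hzA : pt p z ∈ (trivializationAt ℂ A p).baseSet := hz.2.2.2
  set e : (⨂[ℂ]^k (L (pt p z))) ⊗[ℂ] (⨂[ℂ]^m (A (pt p z))) :=
    (PiTensorProduct.tprod ℂ fun _ => frame L p (pt p z)) ⊗ₜ
      (PiTensorProduct.tprod ℂ fun _ => frame A p (pt p z)) with he
  have h1 : ∀ t : (⨂[ℂ]^k (L (pt p z))) ⊗[ℂ] (⨂[ℂ]^m (A (pt p z))), ∃ c : ℂ, t = c • e := by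
    intro t
    induction t using TensorProduct.induction_on with
    | zero => exact ⟨0, by simp⟩
    | add a b ha hb =>
      obtain ⟨c, rfl⟩ := ha
      obtain ⟨d, rfl⟩ := hb
      exact ⟨c + d, by rw [add_smul]⟩
    | tmul a b =>
      refine ⟨powCoeff L k p _ a * powCoeff A m p _ b, ?_⟩
      conv_lhs => rw [eq_powCoeff_smul hzL a, eq_powCoeff_smul hzA b]
      rw [TensorProduct.smul_tmul_smul]
  have h2 : ∃ α, ξ = e ⊗ₜ α := by
    clear hξ
    induction ξ using TensorProduct.induction_on with
    | zero => exact ⟨0, by simp⟩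
    | add a b ha hb =>
      obtain ⟨c, rfl⟩ := ha
      obtain ⟨d, rfl⟩ := hb
      exact ⟨c + d, by rw [TensorProduct.tmul_add]⟩
    | tmul a b =>
      obtain ⟨c, rfl⟩ := h1 a
      exact ⟨c • b, by rw [TensorProduct.smul_tmul]⟩
  obtain ⟨α, rfl⟩ := h2
  have h3 : coeff L A k m p z (e ⊗ₜ α) = canCoeff p z α := by
    simp only [coeff, he, LinearMap.comp_apply, TensorProduct.map_tmul, LinearMap.mul'_apply]
    rw [powCoeff_tprod_frame hzL, powCoeff_tprod_frame hzA]
    simp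
  rw [h3] at hξ
  have h4 : α = 0 := canCoeff_injective hz.1 (hξ.trans (map_zero _).symm)
  rw [h4, TensorProduct.tmul_zero]

variable (hL : HermitianMetric (n := n) L) (hA : HermitianMetric (n := n) A)

theorem pairing_self_eq (s : ∀ x, AdjFibre (n := n) L A k m x) (p : X) (z : Fin n → ℂ) :
    pairing k m hL hA s s p z =
      ((‖coeff L A k m p z (s (pt p z))‖ ^ 2 *
        (hL.frameNormSq p z ^ k * hA.frameNormSq p z ^ m) : ℝ) : ℂ) := by
  rw [pairing, Complex.mul_conj, Complex.normSq_eq_norm_sq]; push_cast; rfl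

theorem weight_pos {p : X} {z : Fin n → ℂ} (hz : z ∈ coordSet p (adjNhd (n := n) L A p)) :
    0 < hL.frameNormSq p z ^ k * hA.frameNormSq p z ^ m :=
  mul_pos (pow_pos (hL.frameNormSq_pos hz.2.1.2) _) (pow_pos (hA.frameNormSq_pos hz.2.2.2) _)

theorem pairing_self_re_nonneg (s : ∀ x, AdjFibre (n := n) L A k m x) {p : X} {z : Fin n → ℂ}
    (hz : z ∈ coordSet p (adjNhd (n := n) L A p)) : 0 ≤ (pairing k m hL hA s s p z).re := by
  rw [pairing_self_eq, Complex.ofReal_re]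
  exact mul_nonneg (sq_nonneg _) (weight_pos hL hA hz).le

theorem continuousOn_pairing (s t : H0 (n := n) L A k m) (p : X) :
    ContinuousOn (pairing k m hL hA s t p) (coordSet p (adjNhd (n := n) L A p)) := by
  have h1 := (s.2 p).continuousOn
  have h2 := (t.2 p).continuousOn
  have h3 : ContinuousOn (hL.frameNormSq p) (coordSet p (adjNhd (n := n) L A p)) :=
    (hL.smooth p).continuousOn.mono (coordSet_mono p Set.inter_subset_left)
  have h4 : ContinuousOn (hA.frameNormSq p) (coordSet p (adjNhd (n := n) L A p)) :=
    (hA.smooth p).continuousOn.mono (coordSet_mono p Set.inter_subset_right)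
  exact (h1.mul (Complex.continuous_conj.comp_continuousOn h2)).mul
    (Complex.continuous_ofReal.comp_continuousOn ((h3.pow k).mul (h4.pow m)))

theorem norm_pairing_le (s t : ∀ x, AdjFibre (n := n) L A k m x) {p : X} {z : Fin n → ℂ}
    (hz : z ∈ coordSet p (adjNhd (n := n) L A p)) :
    ‖pairing k m hL hA s t p z‖ ≤
      (pairing k m hL hA s s p z).re + (pairing k m hL hA t t p z).re := by
  rw [pairing_self_eq, pairing_self_eq, Complex.ofReal_re, Complex.ofReal_re, pairing, norm_mul,
    norm_mul, Complex.norm_conj, Complex.norm_real, Real.norm_of_nonneg (weight_pos hL hA hz).le,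
    ← add_mul]
  refine mul_le_mul_of_nonneg_right ?_ (weight_pos hL hA hz).le
  nlinarith [sq_nonneg (‖coeff L A k m p z (s (pt p z))‖ - ‖coeff L A k m p z (t (pt p z))‖),
    sq_nonneg (‖coeff L A k m p z (s (pt p z))‖), sq_nonneg (‖coeff L A k m p z (t (pt p z))‖)]

section

variable [CompactSpace X]

theorem aestronglyMeasurable_pairing (s t : H0 (n := n) L A k m)
    (i : Fin (coverCard (n := n) L A)) :
    AEStronglyMeasurable (pairing k m hL hA s t (coverPt (n := n) L A i))
      (volume.restrict (coordSet (coverPt (n := n) L A i) (coverPiece (n := n) L A i))) :=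
  ((continuousOn_pairing hL hA s t _).aestronglyMeasurable
    (isOpen_coordSet _ (isOpen_adjNhd L A _)).measurableSet).mono_set
      (coordSet_mono _ (coverPiece_subset L A i))

theorem hilb_smul_left (c : ℂ) (s u : H0 (n := n) L A k m) :
    hilb hL hA (c • s) u = c * hilb hL hA s u := by
  simp only [hilb, integralForm]
  rw [Finset.mul_sum]
  refine Finset.sum_congr rfl fun i _ => ?_
  rw [← integral_const_mul]
  congr 1; ext z
  simp only [pairing, Submodule.coe_smul, Pi.smul_apply, map_smul, smul_eq_mul]
  ring

theorem conj_hilb (s t : H0 (n := n) L A k m) : conj (hilb hL hA s t) = hilb hL hA t s := by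
  simp only [hilb, integralForm]
  rw [map_sum]
  refine Finset.sum_congr rfl fun i _ => ?_
  rw [← integral_conj]
  congr 1; ext z
  simp only [pairing, map_mul, Complex.conj_conj, Complex.conj_ofReal]
  ring

end

variable [IsManifold 𝓘(ℂ, Fin n → ℂ) ω X]

theorem isDensity_pairing_self (s : ∀ x, AdjFibre (n := n) L A k m x) :
    IsDensity L A fun p z => (pairing k m hL hA s s p z).re := fun p q z hz => by
  simp only
  rw [pairing_transition hL hA hz, Complex.re_ofReal_mul]

end Sections

/-! ### The Hilbert space of sections -/

section Hilbert

open MeasureTheory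

variable {n : ℕ} {X : Type*} [TopologicalSpace X] [ChartedSpace (Fin n → ℂ) X]
  {L : X → Type*} [TopologicalSpace (Bundle.TotalSpace ℂ L)] [∀ x, TopologicalSpace (L x)]
  [∀ x, AddCommGroup (L x)] [∀ x, Module ℂ (L x)] [FiberBundle ℂ L] [VectorBundle ℂ ℂ L]
  {A : X → Type*} [TopologicalSpace (Bundle.TotalSpace ℂ A)] [∀ x, TopologicalSpace (A x)]
  [∀ x, AddCommGroup (A x)] [∀ x, Module ℂ (A x)] [FiberBundle ℂ A] [VectorBundle ℂ ℂ A]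
  {k m : ℕ}

variable (hL : HermitianMetric (n := n) L) (hA : HermitianMetric (n := n) A)
variable [IsManifold 𝓘(ℂ, Fin n → ℂ) ω X] [CompactSpace X] [T2Space X]

set_option linter.unusedSectionVars false in
theorem pairing_self_nonneg (s : H0 (n := n) L A k m) {p : X} {z : Fin n → ℂ}
    (hz : z ∈ coordSet p (adjNhd (n := n) L A p)) : 0 ≤ (pairing k m hL hA s s p z).re :=
  pairing_self_re_nonneg hL hA (s : ∀ x, AdjFibre (n := n) L A k m x) hz

theorem mass_pairing_lt_top (s : H0 (n := n) L A k m) :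
    mass L A (fun p z => (pairing k m hL hA s s p z).re) < ⊤ := by
  have h1 := isDensity_pairing_self hL hA (s : ∀ x, AdjFibre (n := n) L A k m x)
  have h2 : ∀ p, ContinuousOn (fun z => (pairing k m hL hA s s p z).re)
      (coordSet p (adjNhd (n := n) L A p)) := fun p =>
    Complex.continuous_re.comp_continuousOn (continuousOn_pairing hL hA s s p)
  exact h1.mass_lt_top h2

theorem integrableOn_pairing (s t : H0 (n := n) L A k m) (i : Fin (coverCard (n := n) L A)) :
    IntegrableOn (pairing k m hL hA s t (coverPt (n := n) L A i))
      (coordSet (coverPt (n := n) L A i) (coverPiece (n := n) L A i)) := by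
  have hms := measurableSet_coordSet (n := n) (coverPt (n := n) L A i)
    (measurableSet_coverPiece L A i)
  have hself : ∀ u : H0 (n := n) L A k m, IntegrableOn
      (fun z => (pairing k m hL hA u u (coverPt (n := n) L A i) z).re)
      (coordSet (coverPt (n := n) L A i) (coverPiece (n := n) L A i)) := by
    intro u
    refine ⟨(Complex.continuous_re.comp_aestronglyMeasurable
      (aestronglyMeasurable_pairing hL hA u u i)), ?_⟩
    rw [hasFiniteIntegral_iff_ofReal]
    · have h1 := mass_pairing_lt_top hL hA u
      rw [mass, ENNReal.sum_lt_top] at h1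
      exact h1 i (Finset.mem_univ i)
    · exact (ae_restrict_iff' hms).2 (Filter.Eventually.of_forall fun z hz =>
        pairing_self_nonneg hL hA u (p := coverPt (n := n) L A i) (z := z)
          (coordSet_mono (coverPt (n := n) L A i) (coverPiece_subset (n := n) L A i) hz))
  refine ((hself s).add (hself t)).mono' (aestronglyMeasurable_pairing hL hA s t i) ?_
  exact (ae_restrict_iff' hms).2 (Filter.Eventually.of_forall fun z hz =>
    norm_pairing_le hL hA (s : ∀ x, AdjFibre (n := n) L A k m x)
      (t : ∀ x, AdjFibre (n := n) L A k m x) (p := coverPt (n := n) L A i) (z := z)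
      (coordSet_mono (coverPt (n := n) L A i) (coverPiece_subset (n := n) L A i) hz))

theorem hilb_self (s : H0 (n := n) L A k m) :
    hilb hL hA s s = ((mass L A fun p z => (pairing k m hL hA s s p z).re).toReal : ℂ) := by
  have hfin := mass_pairing_lt_top hL hA s
  rw [mass, ENNReal.sum_lt_top] at hfin
  rw [mass, ENNReal.toReal_sum fun i hi => (hfin i hi).ne, Complex.ofReal_sum, hilb, integralForm]
  refine Finset.sum_congr rfl fun i _ => ?_
  have hms := measurableSet_coordSet (n := n) (coverPt (n := n) L A i)
    (measurableSet_coverPiece L A i)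
  rw [← integral_eq_lintegral_of_nonneg_ae, ← integral_complex_ofReal]
  · congr 1; ext z
    rw [pairing_self_eq, Complex.ofReal_re]
  · exact (ae_restrict_iff' hms).2 (Filter.Eventually.of_forall fun z hz =>
      pairing_self_nonneg hL hA s (p := coverPt (n := n) L A i) (z := z)
        (coordSet_mono (coverPt (n := n) L A i) (coverPiece_subset (n := n) L A i) hz))
  · exact Complex.continuous_re.comp_aestronglyMeasurable
      (aestronglyMeasurable_pairing hL hA s s i)

theorem hilb_add_left (s t u : H0 (n := n) L A k m) :
    hilb hL hA (s + t) u = hilb hL hA s u + hilb hL hA t u := by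
  simp only [hilb, integralForm]
  rw [← Finset.sum_add_distrib]
  refine Finset.sum_congr rfl fun i _ => ?_
  rw [← integral_add (integrableOn_pairing hL hA s u i) (integrableOn_pairing hL hA t u i)]
  congr 1; ext z
  simp only [pairing, Submodule.coe_add, Pi.add_apply, map_add]
  ring

theorem ofReal_hilb_self (s : H0 (n := n) L A k m) :
    ENNReal.ofReal (hilb hL hA s s).re = mass L A fun p z => (pairing k m hL hA s s p z).re := by
  rw [hilb_self, Complex.ofReal_re, ENNReal.ofReal_toReal (mass_pairing_lt_top hL hA s).ne]

/-- The `L²` norm on a measurable part of a coordinate neighbourhood is at most the global one. -/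
theorem setIntegral_pairing_le_hilb (s : H0 (n := n) L A k m) {q : X} {B : Set (Fin n → ℂ)}
    (hB : IsCompact B) (hBq : B ⊆ coordSet q (adjNhd (n := n) L A q)) :
    ∫ z in B, (pairing k m hL hA s s q z).re ≤ (hilb hL hA s s).re := by
  let _ : MeasurableSpace X := borel X
  have _ : BorelSpace X := ⟨rfl⟩
  have hBt : B ⊆ (chartAt (Fin n → ℂ) q).target := fun z hz => (hBq hz).1
  have h1 := (isDensity_pairing_self hL hA (s : ∀ x, AdjFibre (n := n) L A k m x)).lintegral_le_mass
    (q := q) (isCompact_image_pt hB hBt).measurableSet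
    (by rintro _ ⟨z, hz, rfl⟩; exact (hBq hz).2)
  rw [coordSet_image_pt hBt] at h1
  have hc : ContinuousOn (fun z => (pairing k m hL hA s s q z).re) B :=
    (Complex.continuous_re.comp_continuousOn (continuousOn_pairing hL hA s s q)).mono hBq
  rw [integral_eq_lintegral_of_nonneg_ae
    ((ae_restrict_iff' hB.measurableSet).2 (Filter.Eventually.of_forall fun z hz =>
      pairing_self_nonneg hL hA s (hBq hz))) (hc.aestronglyMeasurable hB.measurableSet),
    hilb_self, Complex.ofReal_re]
  exact ENNReal.toReal_mono (mass_pairing_lt_top hL hA s).ne h1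

/-- A section of norm zero vanishes: its density is continuous and zero almost everywhere, hence
zero. -/
theorem eq_zero_of_hilb_self_eq_zero {s : H0 (n := n) L A k m} (hs : hilb hL hA s s = 0) :
    s = 0 := by
  have hm : mass L A (fun p z => (pairing k m hL hA s s p z).re) = 0 := by
    rw [← ofReal_hilb_self, hs]; simp
  let _ : MeasurableSpace X := borel X
  have _ : BorelSpace X := ⟨rfl⟩
  refine Subtype.ext (funext fun x => ?_)
  have hxN := mem_adjNhd (n := n) L A x
  have hUo := isOpen_coordSet (n := n) x (isOpen_adjNhd (n := n) L A x)
  have h1 := (isDensity_pairing_self hL hA (s : ∀ x, AdjFibre (n := n) L A k m x)).lintegral_le_mass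
    (q := x) (isOpen_adjNhd (n := n) L A x).measurableSet le_rfl
  rw [hm, nonpos_iff_eq_zero] at h1
  have hc : ContinuousOn (fun z => (pairing k m hL hA s s x z).re)
      (coordSet x (adjNhd (n := n) L A x)) :=
    Complex.continuous_re.comp_continuousOn (continuousOn_pairing hL hA s s x)
  rw [lintegral_eq_zero_iff'
    (hc.aestronglyMeasurable hUo.measurableSet).aemeasurable.ennreal_ofReal] at h1
  have h2 : (fun z => (pairing k m hL hA s s x z).re) =ᵐ[volume.restrict
      (coordSet x (adjNhd (n := n) L A x))] fun _ => 0 := by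
    filter_upwards [h1, ae_restrict_mem hUo.measurableSet] with z hz hzU
    exact le_antisymm (ENNReal.ofReal_eq_zero.1 hz) (pairing_self_nonneg hL hA s hzU)
  have h3 := Measure.eqOn_open_of_ae_eq h2 hUo hc continuousOn_const
  have hz : chartAt (Fin n → ℂ) x x ∈ coordSet x (adjNhd (n := n) L A x) := by
    refine ⟨mem_chart_target _ x, ?_⟩
    rw [Set.mem_preimage, (chartAt (Fin n → ℂ) x).left_inv (mem_chart_source _ x)]
    exact hxN
  have h4 := h3 hz
  simp only at h4
  rw [pairing_self_eq, Complex.ofReal_re, mul_eq_zero, or_iff_left (weight_pos hL hA hz).ne',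
    sq_eq_zero_iff, norm_eq_zero] at h4
  have h5 := eq_zero_of_coeff_eq_zero hz h4
  have hx : pt x (chartAt (Fin n → ℂ) x x) = x :=
    (chartAt (Fin n → ℂ) x).left_inv (mem_chart_source _ x)
  rw [hx] at h5
  exact h5

/-- Negation on the space of sections, given by multiplication with `-1`, over the additive monoid
structure of the submodule. -/
instance : AddCommGroup (H0 (n := n) L A k m) := Module.addCommMonoidToAddCommGroup ℂ

/-- The Hilbert inner product, as an inner product that is linear in the second variable. -/
abbrev hilbCore : InnerProductSpace.Core ℂ (H0 (n := n) L A k m) where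
  inner s t := hilb hL hA t s
  conj_inner_symm s t := conj_hilb hL hA s t
  re_inner_nonneg s := by
    rw [hilb_self]
    exact ENNReal.toReal_nonneg
  add_left s t u := by
    rw [← conj_hilb, hilb_add_left, map_add, conj_hilb, conj_hilb]
  smul_left s t c := by
    rw [← conj_hilb, hilb_smul_left, map_mul, conj_hilb]
  definite _ hs := eq_zero_of_hilb_self_eq_zero hL hA hs

/-- Parseval's identity for a finite orthonormal system. -/
theorem hilb_sum_smul_self {N : ℕ} {σ : Fin N → H0 (n := n) L A k m}
    (hσ : ∀ i j, hilb hL hA (σ i) (σ j) = if i = j then 1 else 0) (c : Fin N → ℂ) :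
    (hilb hL hA (∑ j, c j • σ j) (∑ j, c j • σ j)).re = ∑ j, ‖c j‖ ^ 2 := by
  let _ : NormedAddCommGroup (H0 (n := n) L A k m) := (hilbCore hL hA).toNormedAddCommGroup
  let _ : InnerProductSpace ℂ (H0 (n := n) L A k m) :=
    InnerProductSpace.ofCore (hilbCore hL hA).toCore
  have ho : Orthonormal ℂ σ := by
    rw [orthonormal_iff_ite]
    intro i j
    refine (hσ j i).trans ?_
    simp only [eq_comm]
  have h := ho.inner_sum c c Finset.univ
  have h' : hilb hL hA (∑ j, c j • σ j) (∑ j, c j • σ j) = ∑ j, conj (c j) * c j := h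
  rw [h', Complex.re_sum]
  refine Finset.sum_congr rfl fun j _ => ?_
  rw [mul_comm, Complex.mul_conj, Complex.normSq_eq_norm_sq, Complex.ofReal_re]

/-- If the sizes of the orthonormal systems are bounded, then there is a finite orthonormal basis:
every finite linearly independent family can be orthonormalized. -/
theorem exists_isOrthonormalBasis_of_bound {b : ℕ}
    (hb : ∀ (N : ℕ) (σ : Fin N → H0 (n := n) L A k m),
      (∀ i j, hilb hL hA (σ i) (σ j) = if i = j then 1 else 0) → N ≤ b) :
    ∃ (N : ℕ) (σ : Fin N → H0 (n := n) L A k m), IsOrthonormalBasis hL hA σ := by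
  let _ : NormedAddCommGroup (H0 (n := n) L A k m) := (hilbCore hL hA).toNormedAddCommGroup
  let _ : InnerProductSpace ℂ (H0 (n := n) L A k m) :=
    InnerProductSpace.ofCore (hilbCore hL hA).toCore
  have hon : ∀ (N : ℕ) (σ : Fin N → H0 (n := n) L A k m), Orthonormal ℂ σ →
      ∀ i j, hilb hL hA (σ i) (σ j) = if i = j then 1 else 0 := by
    intro N σ ho i j
    refine Eq.trans (orthonormal_iff_ite.1 ho j i) ?_
    simp only [eq_comm]
  have hfin : Module.Finite ℂ (H0 (n := n) L A k m) := by
    rw [← Module.rank_lt_aleph0_iff]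
    refine (rank_le (n := b) fun s hs => ?_).trans_lt (Cardinal.natCast_lt_aleph0)
    let W := Submodule.span ℂ (s : Set (H0 (n := n) L A k m))
    have : Module.Finite ℂ W := Module.Finite.span_finset ℂ s
    have hrank : Module.finrank ℂ W = s.card := finrank_span_finset_eq_card hs
    have ho := (stdOrthonormalBasis ℂ W).orthonormal.comp_linearIsometry W.subtypeₗᵢ
    rw [← hrank]
    exact hb _ _ (hon _ _ ho)
  refine ⟨_, stdOrthonormalBasis ℂ (H0 (n := n) L A k m),
    hon _ _ (stdOrthonormalBasis ℂ (H0 (n := n) L A k m)).orthonormal, ?_⟩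
  have := (stdOrthonormalBasis ℂ (H0 (n := n) L A k m)).toBasis.span_eq
  rwa [OrthonormalBasis.coe_toBasis] at this

end Hilbert

/-! ### The global estimate -/

section Global

open MeasureTheory

variable {n : ℕ} {X : Type*} [TopologicalSpace X] [ChartedSpace (Fin n → ℂ) X]
  {L : X → Type*} [TopologicalSpace (Bundle.TotalSpace ℂ L)] [∀ x, TopologicalSpace (L x)]
  [∀ x, AddCommGroup (L x)] [∀ x, Module ℂ (L x)] [FiberBundle ℂ L] [VectorBundle ℂ ℂ L]
  {A : X → Type*} [TopologicalSpace (Bundle.TotalSpace ℂ A)] [∀ x, TopologicalSpace (A x)]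
  [∀ x, AddCommGroup (A x)] [∀ x, Module ℂ (A x)] [FiberBundle ℂ A] [VectorBundle ℂ ℂ A]
  {k m : ℕ} (hL : HermitianMetric (n := n) L) (hA : HermitianMetric (n := n) A)

theorem pairing_self_re_eq_exp (s : H0 (n := n) L A k m) {ε : ℝ} (hm : (m : ℝ) = ε * k)
    {p : X} {z : Fin n → ℂ} (hz : z ∈ coordSet p (adjNhd (n := n) L A p)) :
    (pairing k m hL hA s s p z).re = ‖coeff L A k m p z (s.1 (pt p z))‖ ^ 2 *
      Real.exp (-(k * (hL.weight p z + ε * hA.weight p z))) := by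
  rw [pairing_self_eq, Complex.ofReal_re, hL.frameNormSq_eq_exp hz.2.1.2,
    hA.frameNormSq_eq_exp hz.2.2.2, ← Real.exp_nat_mul, ← Real.exp_nat_mul, ← Real.exp_add, hm]
  congr 2
  ring

set_option linter.unusedSectionVars false in
theorem det_curvature_nonneg (hL_semipos : hL.Semipositive) (hA_pos : hA.Positive) {ε : ℝ}
    (hε : 0 < ε) {p : X} {z : Fin n → ℂ} (hz : z ∈ coordSet p (adjNhd (n := n) L A p)) :
    0 ≤ (hL.curvature p z + (ε : ℂ) • hA.curvature p z).det.re := by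
  have h1 := hL_semipos p z (coordSet_mono p Set.inter_subset_left hz)
  have h2 := (hA_pos p z (coordSet_mono p Set.inter_subset_right hz)).posSemidef
  have h3 : (0 : ℂ) ≤ (ε : ℂ) := by exact_mod_cast hε.le
  exact (Complex.le_def.1 (h1.add (h2.smul h3)).det_nonneg).1

theorem continuousOn_det_curvature (ε : ℝ) (q : X) :
    ContinuousOn (fun z => (hL.curvature q z + (ε : ℂ) • hA.curvature q z).det.re)
      (coordSet q (adjNhd (n := n) L A q)) := by
  have hU := isOpen_coordSet (n := n) q (isOpen_adjNhd (n := n) L A q)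
  have h1 : ContinuousOn (hL.curvature q) (coordSet q (adjNhd (n := n) L A q)) :=
    leviMatrix_continuousOn hU
      ((hL.contDiffOn_weight q).mono (coordSet_mono q Set.inter_subset_left))
  have h2 : ContinuousOn (hA.curvature q) (coordSet q (adjNhd (n := n) L A q)) :=
    leviMatrix_continuousOn hU
      ((hA.contDiffOn_weight q).mono (coordSet_mono q Set.inter_subset_right))
  exact Complex.continuous_re.comp_continuousOn
    ((Continuous.matrix_det continuous_id).comp_continuousOn (h1.add (h2.const_smul (ε : ℂ))))

theorem bergmanDensity_transition [IsManifold 𝓘(ℂ, Fin n → ℂ) ω X] {N : ℕ}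
    (σ : Fin N → H0 (n := n) L A k m) {p q : X} {z : Fin n → ℂ}
    (hz : z ∈ coordSet p (adjNhd (n := n) L A p ∩ adjNhd (n := n) L A q)) :
    bergmanDensity hL hA σ p z = ‖(fderiv ℂ (transition p q) z).det‖ ^ 2 *
      bergmanDensity hL hA σ q (transition p q z) := by
  simp only [bergmanDensity, Finset.mul_sum]
  refine Finset.sum_congr rfl fun j _ => ?_
  rw [pairing_transition hL hA hz, Complex.re_ofReal_mul]

/-- The determinant of the curvature transforms as a density, being a multiple of the top power of
the curvature form. -/
theorem det_curvature_transition [IsManifold 𝓘(ℂ, Fin n → ℂ) ω X]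
    [ContMDiffVectorBundle ω ℂ L 𝓘(ℂ, Fin n → ℂ)] [ContMDiffVectorBundle ω ℂ A 𝓘(ℂ, Fin n → ℂ)]
    (ε : ℝ) {p q : X} {z : Fin n → ℂ}
    (hz : z ∈ coordSet p (adjNhd (n := n) L A p ∩ adjNhd (n := n) L A q)) :
    (hL.curvature p z + (ε : ℂ) • hA.curvature p z).det.re =
      ‖(fderiv ℂ (transition p q) z).det‖ ^ 2 *
        (hL.curvature q (transition p q z) +
          (ε : ℂ) • hA.curvature q (transition p q z)).det.re := by
  have h1 := hL.curvature_transition (p := p) (q := q) (z := z)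
    ⟨hz.1, hz.2.1.1, hz.2.2.1⟩
  have h2 := hA.curvature_transition (p := p) (q := q) (z := z)
    ⟨hz.1, hz.2.1.2, hz.2.2.2⟩
  set J := LinearMap.toMatrix' (fderiv ℂ (transition p q) z : (Fin n → ℂ) →ₗ[ℂ] (Fin n → ℂ))
  have hJ : J.det = (fderiv ℂ (transition p q) z).det := LinearMap.det_toMatrix' _
  have hJc : (J.map conj).det = conj J.det := (RingHom.map_det (starRingEnd ℂ) J).symm
  have e : hL.curvature p z + (ε : ℂ) • hA.curvature p z = J.transpose *
      (hL.curvature q (transition p q z) + (ε : ℂ) • hA.curvature q (transition p q z)) *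
        J.map conj := by
    rw [h1, h2, Matrix.mul_add, Matrix.add_mul, Matrix.mul_smul, Matrix.smul_mul]
  rw [e, Matrix.det_mul, Matrix.det_mul, Matrix.det_transpose, hJc, hJ, mul_right_comm,
    Complex.mul_conj, Complex.normSq_eq_norm_sq, Complex.re_ofReal_mul]

variable [CompactSpace X] [T2Space X] [IsManifold 𝓘(ℂ, Fin n → ℂ) ω X]

/-- The extremal characterization of the Bergman kernel: a pointwise bound for all sections by
their global norm bounds the Bergman density, since the section `∑ conj (σ_j(z)) σ_j` attains the
supremum at `z`. -/
theorem bergmanDensity_mul_le_of_forall {N : ℕ} {σ : Fin N → H0 (n := n) L A k m}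
    (hσ : ∀ i j, hilb hL hA (σ i) (σ j) = if i = j then 1 else 0) {p : X} {z : Fin n → ℂ} {C D : ℝ}
    (hC : 0 ≤ C) (h : ∀ s : H0 (n := n) L A k m,
      (pairing k m hL hA s s p z).re * D ≤ C * (hilb hL hA s s).re) :
    bergmanDensity hL hA σ p z * D ≤ C := by
  set w := hL.frameNormSq p z ^ k * hA.frameNormSq p z ^ m with hw
  set c : Fin N → ℂ := fun j => coeff L A k m p z ((σ j : ∀ x, _) (pt p z)) with hc
  set S := ∑ j, ‖c j‖ ^ 2 with hS
  have hB : bergmanDensity hL hA σ p z = S * w := by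
    simp only [bergmanDensity, pairing_self_eq, Complex.ofReal_re, hS, Finset.sum_mul]
    rfl
  have hs := h (∑ j, conj (c j) • σ j)
  have hval : coeff L A k m p z (((∑ j, conj (c j) • σ j : H0 (n := n) L A k m) : ∀ x, _)
      (pt p z)) = (S : ℂ) := by
    have e : ((∑ j, conj (c j) • σ j : H0 (n := n) L A k m) : ∀ x, _) (pt p z) =
        ∑ j, conj (c j) • (σ j : ∀ x, AdjFibre (n := n) L A k m x) (pt p z) := by
      rw [Submodule.coe_sum, Finset.sum_apply]
      rfl
    rw [e, map_sum, hS, Complex.ofReal_sum]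
    refine Finset.sum_congr rfl fun j _ => ?_
    rw [map_smul, smul_eq_mul, mul_comm]
    change c j * conj (c j) = _
    rw [Complex.mul_conj, Complex.normSq_eq_norm_sq]
  have hS0 : 0 ≤ S := Finset.sum_nonneg fun j _ => sq_nonneg _
  rw [hilb_sum_smul_self hL hA hσ, pairing_self_eq, hval, Complex.ofReal_re, Complex.norm_real,
    Real.norm_of_nonneg hS0] at hs
  simp only [Complex.norm_conj, ← hS, ← hw] at hs
  rw [hB]
  -- The hypothesis for the extremal section reads `S² w D ≤ C S`.
  rcases hS0.eq_or_lt with h0 | h0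
  · rw [← h0]; simpa using hC
  · refine le_of_mul_le_mul_right ?_ h0
    calc S * w * D * S = S ^ 2 * w * D := by ring
      _ ≤ C * S := hs

/-- The local estimate near a point, with the local mass replaced by the global norm. -/
theorem exists_local_section_bound (hL_semipos : hL.Semipositive) (hA_pos : hA.Positive) (q : X) :
    ∃ r > 0, Metric.closedBall (chartAt (Fin n → ℂ) q q) r ⊆ coordSet q (adjNhd (n := n) L A q) ∧
      ∃ (δ : ℕ → ℝ) (k₀ : ℕ), Filter.Tendsto δ Filter.atTop (nhds 0) ∧ 2 ≤ k₀ ∧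
      ∀ k m : ℕ, k₀ ≤ k → ∀ ε : ℝ, 0 < ε → (m : ℝ) = ε * k →
      ∀ z ∈ Metric.closedBall (chartAt (Fin n → ℂ) q q) r, ∀ s : H0 (n := n) L A k m,
        (pairing k m hL hA s s q z).re *
            (Real.pi * (1 - Real.exp (-(ε * Real.log k ^ 2)))) ^ n ≤
          k ^ n * (hL.curvature q z + (ε : ℂ) • hA.curvature q z).det.re *
            Real.exp (δ k + ε * δ k) * (hilb hL hA s s).re := by
  have hsubL : coordSet (n := n) q (adjNhd (n := n) L A q) ⊆ coordSet q (frameNhd (n := n) L q) :=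
    coordSet_mono q Set.inter_subset_left
  have hsubA : coordSet (n := n) q (adjNhd (n := n) L A q) ⊆ coordSet q (frameNhd (n := n) A q) :=
    coordSet_mono q Set.inter_subset_right
  have hq : chartAt (Fin n → ℂ) q q ∈ coordSet q (adjNhd (n := n) L A q) := by
    refine ⟨mem_chart_target _ q, ?_⟩
    rw [Set.mem_preimage, (chartAt (Fin n → ℂ) q).left_inv (mem_chart_source _ q)]
    exact mem_adjNhd (n := n) L A q
  obtain ⟨r, hr, hrU, δ, k₀, hδ, hk₀, hest⟩ := exists_local_bergman_estimate
    (isOpen_coordSet (n := n) q (isOpen_adjNhd (n := n) L A q))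
    ((hL.contDiffOn_weight q).mono hsubL) ((hA.contDiffOn_weight q).mono hsubA)
    (fun z hz => hL_semipos q z (hsubL hz)) (fun z hz => hA_pos q z (hsubA hz)) hq
  refine ⟨r / 2, half_pos hr, (Metric.closedBall_subset_closedBall (by linarith)).trans hrU,
    δ, k₀, hδ, hk₀, fun k m hk ε hε hm z hz s => ?_⟩
  have hzU := hrU (Metric.closedBall_subset_closedBall (by linarith) hz)
  have h1 := hest k hk ε hε z hz _ (s.2 q)
  rw [pairing_self_re_eq_exp hL hA s hm hzU]
  refine h1.trans (mul_le_mul_of_nonneg_left ?_ ?_)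
  · refine le_trans (le_of_eq ?_)
      (setIntegral_pairing_le_hilb hL hA s (isCompact_closedBall (chartAt (Fin n → ℂ) q q) r) hrU)
    exact setIntegral_congr_fun Metric.isClosed_closedBall.measurableSet fun w hw =>
      (pairing_self_re_eq_exp hL hA s hm (hrU hw)).symm
  · have := det_curvature_nonneg hL hA hL_semipos hA_pos hε hzU
    exact mul_nonneg (mul_nonneg (by positivity) this) (Real.exp_pos _).le

/-- Finitely many coordinate balls covering `X`, on which the local estimate holds with the same
error terms. -/
theorem exists_uniform_section_bound (hL_semipos : hL.Semipositive) (hA_pos : hA.Positive) :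
    ∃ (t : Finset X) (r : X → ℝ) (δ : ℕ → ℝ) (k₀ : ℕ),
      (∀ x, ∃ q ∈ t, x ∈ pt (n := n) q '' Metric.closedBall (chartAt (Fin n → ℂ) q q) (r q)) ∧
      (∀ q, Metric.closedBall (chartAt (Fin n → ℂ) q q) (r q) ⊆
        coordSet q (adjNhd (n := n) L A q)) ∧
      Filter.Tendsto δ Filter.atTop (nhds 0) ∧ 2 ≤ k₀ ∧
      ∀ k m : ℕ, k₀ ≤ k → ∀ ε : ℝ, 0 < ε → (m : ℝ) = ε * k → ∀ q ∈ t,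
      ∀ z ∈ Metric.closedBall (chartAt (Fin n → ℂ) q q) (r q), ∀ s : H0 (n := n) L A k m,
        (pairing k m hL hA s s q z).re *
            (Real.pi * (1 - Real.exp (-(ε * Real.log k ^ 2)))) ^ n ≤
          k ^ n * (hL.curvature q z + (ε : ℂ) • hA.curvature q z).det.re *
            Real.exp (δ k + ε * δ k) * (hilb hL hA s s).re := by
  choose r hr hrU δ k₀ hδ hk₀ hest using
    exists_local_section_bound hL hA hL_semipos hA_pos
  obtain ⟨t, ht⟩ := exists_finite_cover_closedBall (n := n) hr
  refine ⟨t, r, fun k => ∑ q ∈ t, |δ q k|, max 2 (t.sup k₀), ht, hrU, ?_, le_max_left _ _, ?_⟩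
  · simpa using tendsto_finsetSum t fun q _ => (hδ q).abs
  · intro k m hk ε hε hm q hq z hz s
    have hkq : k₀ q ≤ k := (Finset.le_sup hq).trans ((le_max_right _ _).trans hk)
    refine (hest q k m hkq ε hε hm z hz s).trans ?_
    have h1 : δ q k ≤ ∑ q ∈ t, |δ q k| := (le_abs_self _).trans
      (Finset.single_le_sum (f := fun q => |δ q k|) (fun _ _ => abs_nonneg _) hq)
    have h2 := det_curvature_nonneg hL hA hL_semipos hA_pos hε (hrU q hz)
    have h3 : 0 ≤ (hilb hL hA s s).re := by
      rw [hilb_self]; exact ENNReal.toReal_nonneg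
    gcongr

/-- A continuous bound for the Bergman densities of all orthonormal systems bounds the sizes of
these systems, because the size is the total mass of the Bergman density. -/
theorem exists_card_bound {t : Finset X} {r : X → ℝ}
    (ht : ∀ x, ∃ q ∈ t, x ∈ pt (n := n) q '' Metric.closedBall (chartAt (Fin n → ℂ) q q) (r q))
    (hrU : ∀ q, Metric.closedBall (chartAt (Fin n → ℂ) q q) (r q) ⊆
      coordSet q (adjNhd (n := n) L A q))
    {C : X → (Fin n → ℂ) → ℝ} (hC : ∀ q, ContinuousOn (C q) (coordSet q (adjNhd (n := n) L A q)))
    (hB : ∀ (N : ℕ) (σ : Fin N → H0 (n := n) L A k m),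
      (∀ i j, hilb hL hA (σ i) (σ j) = if i = j then 1 else 0) → ∀ q ∈ t,
      ∀ z ∈ Metric.closedBall (chartAt (Fin n → ℂ) q q) (r q),
        bergmanDensity hL hA σ q z ≤ C q z) :
    ∃ b : ℕ, ∀ (N : ℕ) (σ : Fin N → H0 (n := n) L A k m),
      (∀ i j, hilb hL hA (σ i) (σ j) = if i = j then 1 else 0) → N ≤ b := by
  let _ : MeasurableSpace X := borel X
  have _ : BorelSpace X := ⟨rfl⟩
  set B : X → Set (Fin n → ℂ) := fun q => Metric.closedBall (chartAt (Fin n → ℂ) q q) (r q)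
  have hBt : ∀ q, B q ⊆ (chartAt (Fin n → ℂ) q).target := fun q z hz => (hrU q hz).1
  have hBm : ∀ q, MeasurableSet (B q) := fun q => Metric.isClosed_closedBall.measurableSet
  set M : ENNReal := coverCard (n := n) L A *
    ∑ q : t, ∫⁻ z in B q, ENNReal.ofReal (C q z) with hM
  have hMfin : M < ⊤ := by
    refine ENNReal.mul_lt_top (by simp) (ENNReal.sum_lt_top.2 fun q _ => ?_)
    exact (((hC q).mono (hrU q)).integrableOn_compact (isCompact_closedBall _ _)).lintegral_lt_top
  refine ⟨⌈M.toReal⌉₊, fun N σ hσ => ?_⟩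
  have hmass : ∀ j, 1 ≤ coverCard (n := n) L A *
      ∑ q : t, ∫⁻ z in B q, ENNReal.ofReal (pairing k m hL hA (σ j) (σ j) q z).re := by
    intro j
    have h1 := (isDensity_pairing_self hL hA
      (σ j : ∀ x, AdjFibre (n := n) L A k m x)).mass_le (ι := t) (q := fun q => (q : X))
      (S := fun q => pt (q : X) '' B q)
      (fun q => (isCompact_image_pt (isCompact_closedBall _ _) (hBt q)).measurableSet)
      (fun q => by rintro _ ⟨z, hz, rfl⟩; exact (hrU q hz).2)
      (fun x => by obtain ⟨q, hq, hx⟩ := ht x; exact ⟨⟨q, hq⟩, hx⟩)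
    rw [← ofReal_hilb_self, hσ, if_pos rfl] at h1
    simpa [coordSet_image_pt (hBt _)] using h1
  have hN : (N : ENNReal) ≤ M := by
    calc (N : ENNReal) = ∑ _j : Fin N, 1 := by simp
      _ ≤ ∑ j : Fin N, coverCard (n := n) L A *
          ∑ q : t, ∫⁻ z in B q, ENNReal.ofReal (pairing k m hL hA (σ j) (σ j) q z).re :=
        Finset.sum_le_sum fun j _ => hmass j
      _ = coverCard (n := n) L A * ∑ q : t, ∑ j : Fin N,
          ∫⁻ z in B q, ENNReal.ofReal (pairing k m hL hA (σ j) (σ j) q z).re := by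
        rw [← Finset.mul_sum, Finset.sum_comm]
      _ ≤ M := by
        refine mul_le_mul_right (Finset.sum_le_sum fun q _ => ?_) _
        rw [← lintegral_finsetSum']
        · refine setLIntegral_mono' (hBm q) fun z hz => ?_
          rw [← ENNReal.ofReal_sum_of_nonneg fun j _ =>
            pairing_self_nonneg hL hA (σ j) (hrU q hz)]
          exact ENNReal.ofReal_le_ofReal (hB N σ hσ q q.2 z hz)
        · intro j _
          have hc : ContinuousOn (fun z => (pairing k m hL hA (σ j) (σ j) q z).re) (B q) :=
            (Complex.continuous_re.comp_continuousOn
              (continuousOn_pairing hL hA (σ j) (σ j) q)).mono (hrU q)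
          exact (hc.aestronglyMeasurable (hBm q)).aemeasurable.ennreal_ofReal
  have h2 := ENNReal.toReal_mono hMfin.ne hN
  rw [ENNReal.toReal_natCast] at h2
  exact_mod_cast h2.trans (Nat.le_ceil _)

end Global

end AdjointBergman

end

theorem mainTheorem7 {n : ℕ} {X : Type*} [TopologicalSpace X] [T2Space X] [CompactSpace X]
    [ChartedSpace (Fin n → ℂ) X] [IsManifold 𝓘(ℂ, Fin n → ℂ) ω X]
    (L : X → Type*) [TopologicalSpace (Bundle.TotalSpace ℂ L)] [∀ x, TopologicalSpace (L x)]
    [∀ x, AddCommGroup (L x)] [∀ x, Module ℂ (L x)] [FiberBundle ℂ L] [VectorBundle ℂ ℂ L]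
    [ContMDiffVectorBundle ω ℂ L 𝓘(ℂ, Fin n → ℂ)]
    (A : X → Type*) [TopologicalSpace (Bundle.TotalSpace ℂ A)] [∀ x, TopologicalSpace (A x)]
    [∀ x, AddCommGroup (A x)] [∀ x, Module ℂ (A x)] [FiberBundle ℂ A] [VectorBundle ℂ ℂ A]
    [ContMDiffVectorBundle ω ℂ A 𝓘(ℂ, Fin n → ℂ)]
    (hL : AdjointBergman.HermitianMetric (n := n) L) (hL_semipos : hL.Semipositive)
    (hA : AdjointBergman.HermitianMetric (n := n) A) (hA_pos : hA.Positive) :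
    ∃ ρ ρ' : ℕ → X → ℝ,
      TendstoUniformly ρ (fun _ => 0) Filter.atTop ∧
      TendstoUniformly ρ' (fun _ => 0) Filter.atTop ∧
      ∃ k₀ : ℕ, ∀ ε : ℚ, 0 < ε → ∀ k m : ℕ, k₀ ≤ k → (m : ℚ) = ε * k →
        (∃ (N : ℕ) (σ : Fin N → AdjointBergman.H0 (n := n) L A k m),
          AdjointBergman.IsOrthonormalBasis hL hA σ) ∧
        ∀ (N : ℕ) (σ : Fin N → AdjointBergman.H0 (n := n) L A k m),
          AdjointBergman.IsOrthonormalBasis hL hA σ →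
          ∀ (p : X) (z : Fin n → ℂ),
            z ∈ AdjointBergman.coordSet p (AdjointBergman.adjNhd (n := n) L A p) →
            (n.factorial : ℝ) / (k : ℝ) ^ n * AdjointBergman.bergmanDensity hL hA σ p z ≤
              Real.exp (ρ k (AdjointBergman.pt p z) + (ε : ℝ) * ρ' k (AdjointBergman.pt p z)) /
                  (1 - Real.exp (-((ε : ℝ) * Real.log k ^ 2))) ^ n *
                AdjointBergman.topPowerDensity
                  (hL.curvature p z + (ε : ℂ) • hA.curvature p z) := by
  obtain ⟨t, r, δ, k₀, ht, hrU, hδ, hk₀, hest⟩ :=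
    AdjointBergman.exists_uniform_section_bound hL hA hL_semipos hA_pos
  have hunif : TendstoUniformly (fun k (_ : X) => δ k) (fun _ => 0) Filter.atTop := by
    rw [Metric.tendstoUniformly_iff]
    intro e he
    filter_upwards [Metric.tendsto_nhds.1 hδ e he] with k hk x
    rw [dist_comm]
    exact hk
  refine ⟨fun k _ => δ k, fun k _ => δ k, hunif, hunif, k₀, fun ε hε k m hk hm => ?_⟩
  have hεR : (0 : ℝ) < (ε : ℝ) := by exact_mod_cast hε
  have hmR : (m : ℝ) = (ε : ℝ) * k := by exact_mod_cast hm
  have hk2 : 2 ≤ k := hk₀.trans hk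
  have hlog : 0 < Real.log k := Real.log_pos (by exact_mod_cast hk2)
  have hgap : 0 < 1 - Real.exp (-((ε : ℝ) * Real.log k ^ 2)) := by
    rw [sub_pos, Real.exp_lt_one_iff, neg_lt_zero]
    positivity
  -- The hypothesis `2 ≤ k` makes `log k` positive, so that division by `D` is harmless.
  set D := (Real.pi * (1 - Real.exp (-((ε : ℝ) * Real.log k ^ 2)))) ^ n with hDdef
  have hD : 0 < D := by positivity
  set E := Real.exp (δ k + (ε : ℝ) * δ k)
  have hB : ∀ (N : ℕ) (σ : Fin N → AdjointBergman.H0 (n := n) L A k m),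
      (∀ i j, AdjointBergman.hilb hL hA (σ i) (σ j) = if i = j then 1 else 0) → ∀ q ∈ t,
      ∀ z ∈ Metric.closedBall (chartAt (Fin n → ℂ) q q) (r q),
        AdjointBergman.bergmanDensity hL hA σ q z * D ≤
          k ^ n * (hL.curvature q z + ((ε : ℝ) : ℂ) • hA.curvature q z).det.re * E := by
    intro N σ hσ q hq z hz
    have h0 := AdjointBergman.det_curvature_nonneg hL hA hL_semipos hA_pos hεR (hrU q hz)
    exact AdjointBergman.bergmanDensity_mul_le_of_forall hL hA hσ (by positivity)
      fun s => hest k m hk ε hεR hmR q hq z hz s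
  refine ⟨?_, fun N σ hσ p z hz => ?_⟩
  · obtain ⟨b, hb⟩ := AdjointBergman.exists_card_bound (k := k) (m := m) hL hA ht hrU
      (C := fun q z =>
        k ^ n * (hL.curvature q z + ((ε : ℝ) : ℂ) • hA.curvature q z).det.re * E / D)
      (fun q => ((continuousOn_const.mul
        (AdjointBergman.continuousOn_det_curvature hL hA ε q)).mul
          continuousOn_const).div_const _)
      (fun N σ hσ q hq z hz => (le_div_iff₀ hD).2 (hB N σ hσ q hq z hz))
    exact AdjointBergman.exists_isOrthonormalBasis_of_bound hL hA hb
  · -- The estimate holds in the coordinates at some `q` in `t`, and both sides are densities, so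
    -- that it can be transported to the coordinates at `p`.
    obtain ⟨q, hq, w, hw, hwz⟩ := ht (AdjointBergman.pt p z)
    have hwU := hrU q hw
    have hzpq : z ∈ AdjointBergman.coordSet p
        (AdjointBergman.adjNhd (n := n) L A p ∩ AdjointBergman.adjNhd (n := n) L A q) :=
      ⟨hz.1, hz.2, by
        change AdjointBergman.pt p z ∈ _
        rw [← hwz]
        exact hwU.2⟩
    have hwT : AdjointBergman.transition p q z = w := by
      rw [AdjointBergman.transition, ← hwz]
      exact (chartAt (Fin n → ℂ) q).right_inv hwU.1
    have h1 := hB N σ hσ.1 q hq w hw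
    have h2 := AdjointBergman.bergmanDensity_transition hL hA σ hzpq
    have h3 := AdjointBergman.det_curvature_transition hL hA ε hzpq
    rw [hwT] at h2 h3
    have h4 : AdjointBergman.bergmanDensity hL hA σ p z * D ≤
        k ^ n * (hL.curvature p z + ((ε : ℝ) : ℂ) • hA.curvature p z).det.re * E := by
      rw [h2, h3]
      calc _ = ‖(fderiv ℂ (AdjointBergman.transition p q) z).det‖ ^ 2 *
            (AdjointBergman.bergmanDensity hL hA σ q w * D) := by ring
        _ ≤ _ := mul_le_mul_of_nonneg_left h1 (sq_nonneg _)
        _ = _ := by ring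
    rw [AdjointBergman.topPowerDensity_eq]
    have hcast : ((ε : ℝ) : ℂ) = (ε : ℂ) := by push_cast; rfl
    rw [hcast] at h4
    have hk0 : (0 : ℝ) < (k : ℝ) ^ n := by positivity
    have h5 := (le_div_iff₀ hD).2 h4
    calc _ ≤ (n.factorial : ℝ) / (k : ℝ) ^ n *
          (k ^ n * (hL.curvature p z + (ε : ℂ) • hA.curvature p z).det.re * E / D) :=
        mul_le_mul_of_nonneg_left h5 (by positivity)
      _ = _ := by
        have hcancel : ∀ K F d E a g : ℝ, K ≠ 0 → a ≠ 0 → g ≠ 0 →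
            F / K * (K * d * E / (a * g)) = E / g * (F * d / a) := by
          intro K F d E a g _ _ _
          field_simp
        rw [hDdef, mul_pow]
        exact hcancel _ _ _ _ _ _ hk0.ne' (pow_pos Real.pi_pos n).ne' (pow_pos hgap n).ne'
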